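/- **Notation.** For $d\ge 1$, $n\ge 0$ put $[n]_d=\dfrac{q^{dn}-q^{-dn}}{q^d-q^{-d}}$ and $[n]_d^!=[1]_d[2]_d\cdots[n]_d$. Let $\mathbb A=\mathbb Z[q,q^{-1}]$ and $\mathbb A'=\mathbb F_2[q,q^{-1}]$, an $\mathbb A$-algebra by reduction of coefficients modulo $2$. Let $\mathbf U_q^-$ be the negative part of the quantized enveloping algebra of type $A_2$, i.e. the $\mathbb Q(q)$-algebra with generators $f_1,f_2$ and the quantum Serre relations $f_i^2f_j-(q+q^{-1})f_if_jf_i+f_jf_i^2=0$ for $i\neq j$. Put $f_i^{(n)}=f_i^n/[n]_1^!$, let ${}_{\mathbb A}\mathbf U_q^-$ be the $\mathbb A$-subalgebra of $\mathbf U_q^-$ generated by all $f_i^{(n)}$ ($i=1,2$, $n\in\mathbb N$), and let ${}_{\mathbb A'}\mathbf U_q^-=\mathbb A'\otimes_{\mathbb A}{}_{\mathbb A}\mathbf U_q^-$. Let $\sigma$ be the automorphism of these algebras with $\sigma(f_1)=f_2$, $\sigma(f_2)=f_1$. Let ${}_{\mathbb A'}\mathbf U_q^{-,\sigma}$ be the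 subalgebra of $\sigma$-fixed elements of ${}_{\mathbb A'}\mathbf U_q^-$, let $J$ be its $\mathbb A'$-submodule (in fact a two-sided ideal) generated by the elements $x+\sigma(x)$ for $x\in{}_{\mathbb A'}\mathbf U_q^-$ with $\sigma(x)\ne x$, let $\mathbf V_q={}_{\mathbb A'}\mathbf U_q^{-,\sigma}/J$, and let $\pi:{}_{\mathbb A'}\mathbf U_q^{-,\sigma}\to\mathbf V_q$ be the projection. Let $\underline{\mathbf U}_q^-$ be the negative part of the quantized enveloping algebra of type $C_1$, with single generator $\underline f$ and $d=4$, i.e. $\underline{\mathbf U}_q^-=\mathbb Q(q)[\underline f]$. Put $\underline f^{(a)}=\underline f^a/[a]_4^!$, let ${}_{\mathbb A}\underline{\mathbf U}_q^-$ be the $\mathbb A$-subalgebra generated by all $\underline f^{(a)}$ ($a\in\mathbb N$), let ${}_{\mathbb A'}\underline{\mathbf U}_q^-=\mathbb A'\otimes_{\mathbb A}{}_{\mathbb A}\underline{\mathbf U}_q^-$, and write $\underline f^{(a)}$ also for its image there. **Proposition 2.4.** For every $a\ge 0$ the image of $f_2^{(a)}f_1^{(2a)}f_2^{(a)}$ in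 ${}_{\mathbb A'}\mathbf U_q^-$ is $\sigma$-fixed, so that $g^{(a)}=\pi\bigl(f_2^{(a)}f_1^{(2a)}f_2^{(a)}\bigr)\in\mathbf V_q$ is defined. Write $g=g^{(1)}=\pi(f_2f_1^{(2)}f_2)$. Then $$[a]_4^!\,g^{(a)}=g^a\qquad\text{in }\mathbf V_q\text{, for all }a\ge 0,$$ and there is a unique isomorphism of $\mathbb A'$-algebras $\Phi:{}_{\mathbb A'}\underline{\mathbf U}_q^-\to\mathbf V_q$ with $\Phi(\underline f^{(a)})=g^{(a)}$ for all $a\ge 0$. -/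

import Mathlib

open scoped TensorProduct LaurentPolynomial

noncomputable section

namespace QFold

/-! ## Quantum integers -/

/-- The quantum integer `[n]_d = (q^{dn} - q^{-dn}) / (q^d - q^{-d})` in `R[q, q⁻¹]`, written as the
Laurent polynomial `q^{d(n-1)} + q^{d(n-3)} + ⋯ + q^{-d(n-1)}`. -/
def qInt (R : Type) [CommRing R] (d n : ℕ) : R[T;T⁻¹] :=
  ∑ k ∈ Finset.range n, LaurentPolynomial.T ((d : ℤ) * ((n : ℤ) - 1 - 2 * (k : ℤ)))

/-- `(q^d - q^{-d}) [n]_d = q^{dn} - q^{-dn}`. -/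
theorem qInt_spec (R : Type) [CommRing R] (d n : ℕ) :
    ((LaurentPolynomial.T (d : ℤ) - LaurentPolynomial.T (-(d : ℤ))) * qInt R d n : R[T;T⁻¹])
      = LaurentPolynomial.T ((d : ℤ) * n) - LaurentPolynomial.T (-((d : ℤ) * n)) := by
  unfold qInt
  rw [Finset.mul_sum]
  have h : ∀ k ∈ Finset.range n,
      ((LaurentPolynomial.T (d : ℤ) - LaurentPolynomial.T (-(d : ℤ))) *
        LaurentPolynomial.T ((d : ℤ) * ((n : ℤ) - 1 - 2 * (k : ℤ))) : R[T;T⁻¹])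
      = LaurentPolynomial.T ((d : ℤ) * ((n : ℤ) - 2 * (k : ℤ)))
        - LaurentPolynomial.T ((d : ℤ) * ((n : ℤ) - 2 * ((k + 1 : ℕ) : ℤ))) := by
    intro k _
    rw [sub_mul, ← LaurentPolynomial.T_add, ← LaurentPolynomial.T_add]
    congr 2
    · ring
    · push_cast
      ring
  rw [Finset.sum_congr rfl h, Finset.sum_range_sub']
  congr 2
  ring

/-- The quantum factorial `[n]_d^! = [1]_d [2]_d ⋯ [n]_d`. -/
def qFact (R : Type) [CommRing R] (d n : ℕ) : R[T;T⁻¹] :=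
  ∏ k ∈ Finset.range n, qInt R d (k + 1)

/-! ## Coefficient rings -/

/-- `𝔸 = ℤ[q, q⁻¹]`. -/
abbrev A : Type := ℤ[T;T⁻¹]

/-- `ℚ(q)`, realised as the field of fractions of `ℤ[q, q⁻¹]`. -/
abbrev K : Type := FractionRing A

/-- `𝔸' = 𝔽₂[q, q⁻¹]`. -/
abbrev A' : Type := (ZMod 2)[T;T⁻¹]

/-- `𝔸'` as an `𝔸`-algebra by reduction of the coefficients modulo `2`. -/
instance : Algebra A A' :=
  (AddMonoidAlgebra.mapRingHom ℤ (Int.castRingHom (ZMod 2))).toAlgebra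

theorem algebraMap_C_mul_T (n m : ℤ) :
    algebraMap A A' (LaurentPolynomial.C n * LaurentPolynomial.T m)
      = LaurentPolynomial.C (n : ZMod 2) * LaurentPolynomial.T m := by
  rw [← LaurentPolynomial.single_eq_C_mul_T, ← LaurentPolynomial.single_eq_C_mul_T]
  exact AddMonoidAlgebra.map_single _ _ _

/-- The divided power `x^{(n)} = x^n / [n]_d^!` in a `ℚ(q)`-algebra. -/
def divPow {B : Type} [Semiring B] [Algebra K B] (d : ℕ) (x : B) (n : ℕ) : B :=
  (algebraMap A K (qFact ℤ d n))⁻¹ • x ^ n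

/-! ## Cartan data and the negative part of the quantized enveloping algebra -/

/-- A Cartan datum: a symmetric form on the vertices `I` with `(α_i, α_i) ∈ 2ℤ_{>0}` and
`2(α_i, α_j)/(α_i, α_i) ∈ ℤ_{≤ 0}` for `i ≠ j`. -/
structure CartanDatum (I : Type) where
  form : I → I → ℤ
  symm : ∀ i j, form i j = form j i
  pos : ∀ i, 0 < form i i
  even : ∀ i, 2 ∣ form i i
  nonpos : ∀ i j, i ≠ j → form i j ≤ 0
  dvd : ∀ i j, form i i ∣ 2 * form i j

namespace CartanDatum

variable {I : Type} (X : CartanDatum I)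

/-- `d_i = (α_i, α_i) / 2`. -/
def d (i : I) : ℕ := (X.form i i / 2).toNat

/-- The exponent `1 - 2(α_i, α_j)/(α_i, α_i)` of the quantum Serre relation of `i ≠ j`. -/
def serreExp (i j : I) : ℕ := (1 - 2 * X.form i j / X.form i i).toNat

/-- The quantum Serre relations `∑_k (-1)^k f_i^{(k)} f_j f_i^{(m - k)} = 0`, where
`m = 1 - 2(α_i, α_j)/(α_i, α_i)` and `i ≠ j`. -/
inductive SerreRel : FreeAlgebra K I → FreeAlgebra K I → Prop
  | serre (i j : I) (hij : i ≠ j) :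
      SerreRel
        (∑ k ∈ Finset.range (X.serreExp i j + 1),
          (-1) ^ k * divPow (X.d i) (FreeAlgebra.ι K i) k * FreeAlgebra.ι K j *
            divPow (X.d i) (FreeAlgebra.ι K i) (X.serreExp i j - k))
        0

/-- `U_q^-`: the `ℚ(q)`-algebra with generators `f_i` and the quantum Serre relations. -/
def U : Type := RingQuot X.SerreRel

instance : Ring X.U := inferInstanceAs (Ring (RingQuot X.SerreRel))

instance : Algebra K X.U := inferInstanceAs (Algebra K (RingQuot X.SerreRel))

instance : Algebra A X.U := inferInstanceAs (Algebra A (RingQuot X.SerreRel))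

instance : IsScalarTower A K X.U := inferInstanceAs (IsScalarTower A K (RingQuot X.SerreRel))

/-- The quotient map from the free algebra. -/
def mkU : FreeAlgebra K I →ₐ[K] X.U := RingQuot.mkAlgHom K X.SerreRel

/-- A homomorphism out of `U_q^-`, from a homomorphism of the free algebra that respects the
Serre relations. -/
def liftU {B : Type} [Ring B] [Algebra K B] (φ : FreeAlgebra K I →ₐ[K] B)
    (h : ∀ ⦃x y⦄, X.SerreRel x y → φ x = φ y) : X.U →ₐ[K] B :=
  RingQuot.liftAlgHom K ⟨φ, h⟩

theorem liftU_mkU {B : Type} [Ring B] [Algebra K B] (φ : FreeAlgebra K I →ₐ[K] B)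
    (h : ∀ ⦃x y⦄, X.SerreRel x y → φ x = φ y) (x : FreeAlgebra K I) :
    X.liftU φ h (X.mkU x) = φ x :=
  RingQuot.liftAlgHom_mkAlgHom_apply K φ h x

theorem mkU_rel {x y : FreeAlgebra K I} (h : X.SerreRel x y) : X.mkU x = X.mkU y :=
  RingQuot.mkAlgHom_rel K h

theorem hom_ext_U {B : Type} [Ring B] [Algebra K B] {φ ψ : X.U →ₐ[K] B}
    (h : φ.comp X.mkU = ψ.comp X.mkU) : φ = ψ :=
  RingQuot.ringQuot_ext' K φ ψ h

/-- The generators `f_i` of `U_q^-`. -/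
def f (i : I) : X.U := X.mkU (FreeAlgebra.ι K i)

/-- The divided powers `f_i^{(n)} = f_i^n / [n]^!_{d_i}`. -/
def fdiv (i : I) (n : ℕ) : X.U := divPow (X.d i) (X.f i) n

/-- Lusztig's integral form: the `𝔸`-subalgebra of `U_q^-` generated by all `f_i^{(n)}`. -/
def intForm : Subalgebra A X.U :=
  Algebra.adjoin A (Set.range fun p : I × ℕ => X.fdiv p.1 p.2)

/-- `f_i^{(n)}` as an element of the integral form. -/
def fint (i : I) (n : ℕ) : X.intForm :=
  ⟨X.fdiv i n, Algebra.subset_adjoin ⟨(i, n), rfl⟩⟩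

/-- The base change of the integral form to `𝔸' = 𝔽₂[q, q⁻¹]`. -/
def UMod : Type := A' ⊗[A] X.intForm

instance : Ring X.UMod := inferInstanceAs (Ring (A' ⊗[A] X.intForm))

instance : Algebra A' X.UMod := inferInstanceAs (Algebra A' (A' ⊗[A] X.intForm))

/-- The identification of `X.UMod` with the tensor product that defines it. -/
def modEquiv : X.UMod ≃ₐ[A'] A' ⊗[A] X.intForm := AlgEquiv.refl

/-- The image of `f_i^{(n)}` in the base change to `𝔸'`. -/
def fmod (i : I) (n : ℕ) : X.UMod := X.modEquiv.symm (1 ⊗ₜ[A] X.fint i n)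

/-! ### Diagram automorphisms -/

/-- A diagram automorphism: a permutation of the vertices that preserves the form. -/
def IsDiagramAut (s : Equiv.Perm I) : Prop := ∀ i j, X.form (s i) (s j) = X.form i j

variable {X} {s : Equiv.Perm I}

theorem map_divPow {B C : Type} [Semiring B] [Algebra K B] [Semiring C] [Algebra K C] (φ : B →ₐ[K] C)
    (d : ℕ) (x : B) (n : ℕ) : φ (divPow d x n) = divPow d (φ x) n := by
  simp only [divPow, map_smul, map_pow]

/-- The automorphism `σ` of `U_q^-` with `σ(f_i) = f_{s(i)}`. -/
def sigma (hs : X.IsDiagramAut s) : X.U →ₐ[K] X.U :=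
  X.liftU (FreeAlgebra.lift K fun i => X.f (s i)) (by
    rintro _ _ ⟨i, j, hij⟩
    have h := X.mkU_rel (SerreRel.serre (X := X) (s i) (s j) (s.injective.ne hij))
    have hd : X.d (s i) = X.d i := by rw [d, d, hs i i]
    have he : X.serreExp (s i) (s j) = X.serreExp i j := by
      rw [serreExp, serreExp, hs i i, hs i j]
    rw [hd, he] at h
    simp only [map_sum, map_mul, map_pow, map_neg, map_one, map_zero, map_divPow,
      FreeAlgebra.lift_ι_apply] at h ⊢
    exact h)

theorem sigma_f (hs : X.IsDiagramAut s) (i : I) : sigma hs (X.f i) = X.f (s i) := by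
  rw [sigma, f, liftU_mkU, FreeAlgebra.lift_ι_apply]

theorem sigma_fdiv (hs : X.IsDiagramAut s) (i : I) (n : ℕ) :
    sigma hs (X.fdiv i n) = X.fdiv (s i) n := by
  rw [fdiv, fdiv, map_divPow, sigma_f, d, d, hs i i]

theorem sigma_mem (hs : X.IsDiagramAut s) (x : X.U) (hx : x ∈ X.intForm) :
    sigma hs x ∈ X.intForm := by
  have h : X.intForm ≤ X.intForm.comap ((sigma hs).restrictScalars A) := by
    refine Algebra.adjoin_le ?_
    rintro _ ⟨p, rfl⟩
    change sigma hs (X.fdiv p.1 p.2) ∈ X.intForm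
    rw [sigma_fdiv]
    exact Algebra.subset_adjoin ⟨(s p.1, p.2), rfl⟩
  exact h hx

/-- The restriction of `σ` to the integral form. -/
def sigmaInt (hs : X.IsDiagramAut s) : X.intForm →ₐ[A] X.intForm :=
  (((sigma hs).restrictScalars A).comp X.intForm.val).codRestrict X.intForm
    fun x => sigma_mem hs x x.2

/-- The automorphism of the base change to `𝔸'` induced by `σ`. -/
def sigmaMod (hs : X.IsDiagramAut s) : X.UMod →ₐ[A'] X.UMod :=
  (X.modEquiv.symm : A' ⊗[A] X.intForm →ₐ[A'] X.UMod).comp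
    ((Algebra.TensorProduct.map (AlgHom.id A' A') (sigmaInt hs)).comp
      (X.modEquiv : X.UMod →ₐ[A'] A' ⊗[A] X.intForm))

theorem sigmaMod_tmul (hs : X.IsDiagramAut s) (c : A') (y : X.intForm) :
    sigmaMod hs (X.modEquiv.symm (c ⊗ₜ[A] y)) = X.modEquiv.symm (c ⊗ₜ[A] sigmaInt hs y) := by
  simp [sigmaMod]

theorem sigma_iterate (hs : X.IsDiagramAut s) (n : ℕ) (hn : s ^ n = 1) (x : X.U) :
    (sigma hs)^[n] x = x := by
  have hpow : ∀ m : ℕ, ∀ i, (sigma hs ^ m) (X.f i) = X.f ((s ^ m) i) := by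
    intro m
    induction m with
    | zero => intro i; simp
    | succ m ih =>
      intro i
      rw [pow_succ, pow_succ, AlgHom.mul_apply, sigma_f, ih, Equiv.Perm.mul_apply]
  have h : sigma hs ^ n = AlgHom.id K X.U := by
    apply hom_ext_U
    apply FreeAlgebra.hom_ext
    funext i
    have := hpow n i
    rw [hn] at this
    simpa [f] using this
  rw [← AlgHom.coe_pow, h, AlgHom.id_apply]

theorem sigmaMod_iterate (hs : X.IsDiagramAut s) (n : ℕ) (hn : s ^ n = 1) (x : X.UMod) :
    (sigmaMod hs)^[n] x = x := by
  have hint : ∀ m : ℕ, ∀ y : X.intForm,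
      (((sigmaInt hs)^[m] y : X.intForm) : X.U) = (sigma hs)^[m] (y : X.U) := by
    intro m
    induction m with
    | zero => intro y; rfl
    | succ m ih => intro y; rw [Function.iterate_succ_apply, Function.iterate_succ_apply, ih]; rfl
  have htmul : ∀ m : ℕ, ∀ (c : A') (y : X.intForm),
      (sigmaMod hs)^[m] (X.modEquiv.symm (c ⊗ₜ[A] y))
        = X.modEquiv.symm (c ⊗ₜ[A] (sigmaInt hs)^[m] y) := by
    intro m
    induction m with
    | zero => intro c y; rfl
    | succ m ih =>
      intro c y
      rw [Function.iterate_succ_apply, Function.iterate_succ_apply, ← ih, sigmaMod_tmul]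
  obtain ⟨z, rfl⟩ := X.modEquiv.symm.surjective x
  rw [← AlgHom.coe_pow]
  induction z using TensorProduct.induction_on with
  | zero => rw [map_zero, map_zero]
  | tmul c y =>
    rw [AlgHom.coe_pow, htmul]
    congr 2
    apply Subtype.ext
    rw [hint, sigma_iterate hs n hn]
  | add x y hx hy => rw [map_add, map_add, hx, hy]

end CartanDatum

/-! ## Fixed points modulo orbit sums -/

section Orbit

variable {R B : Type} [CommRing R] [Ring B] [Algebra R B] (σ : B →ₐ[R] B)

/-- The subalgebra of `σ`-fixed elements. -/
def fixedAlg : Subalgebra R B := AlgHom.equalizer σ (AlgHom.id R B)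

theorem mem_fixedAlg (x : B) : x ∈ fixedAlg σ ↔ σ x = x := Iff.rfl

/-- The orbit sum `O(x) = ∑_{0 ≤ i < k} σ^i(x)`, with `k ≥ 1` smallest such that `σ^k(x) = x`. -/
def orbitSum (x : B) : B := ∑ i ∈ Finset.range (Function.minimalPeriod σ x), σ^[i] x

/-- The submodule `J` of the algebra of `σ`-fixed elements that is generated by the orbit sums
`O(x)` of all `x` with `σ(x) ≠ x`. -/
def orbitSubmodule : Submodule R (fixedAlg σ) :=
  Submodule.span R {y | ∃ x : B, σ x ≠ x ∧ (y : B) = orbitSum σ x}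

variable {σ} {p : ℕ}

theorem iterate_map_mul (x y : B) (i : ℕ) : σ^[i] (x * y) = σ^[i] x * σ^[i] y := by
  induction i generalizing x y with
  | zero => rfl
  | succ i ih => simp only [Function.iterate_succ_apply, map_mul, ih]

theorem orbitSum_of_ne (hp : p.Prime) (hσ : ∀ x, σ^[p] x = x) (x : B) (hx : σ x ≠ x) :
    orbitSum σ x = ∑ i ∈ Finset.range p, σ^[i] x := by
  have : Fact p.Prime := ⟨hp⟩
  rw [orbitSum, Function.minimalPeriod_eq_prime (hσ x) hx]

theorem fixed_mul_mem (hp : p.Prime) (hpB : (p : B) = 0) (hσ : ∀ x, σ^[p] x = x)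
    (a b y : fixedAlg σ) (hy : y ∈ orbitSubmodule σ) : a * y * b ∈ orbitSubmodule σ := by
  have hfix : ∀ (c : fixedAlg σ) (i : ℕ), σ^[i] (c : B) = c := fun c i =>
    Function.iterate_fixed c.2 i
  refine Submodule.span_induction (p := fun y _ => a * y * b ∈ orbitSubmodule σ)
    ?_ ?_ ?_ ?_ hy
  · rintro y ⟨x, hx, hyx⟩
    have hval : ((a * y * b : fixedAlg σ) : B)
        = ∑ i ∈ Finset.range p, σ^[i] ((a : B) * x * b) := by
      push_cast
      rw [hyx, orbitSum_of_ne hp hσ x hx, Finset.mul_sum, Finset.sum_mul]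
      refine Finset.sum_congr rfl fun i _ => ?_
      rw [iterate_map_mul, iterate_map_mul, hfix, hfix]
    by_cases h : σ ((a : B) * x * b) = (a : B) * x * b
    · have h0 : a * y * b = 0 := by
        apply Subtype.ext
        rw [hval, Finset.sum_congr rfl fun i _ => Function.iterate_fixed h i, Finset.sum_const,
          Finset.card_range, nsmul_eq_mul, hpB, zero_mul]
        rfl
      rw [h0]
      exact Submodule.zero_mem _
    · exact Submodule.subset_span ⟨_, h, by rw [hval, orbitSum_of_ne hp hσ _ h]⟩
  · simp
  · intro y z _ _ hy hz
    rw [mul_add, add_mul]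
    exact Submodule.add_mem _ hy hz
  · intro r y _ hy
    rw [mul_smul_comm, smul_mul_assoc]
    exact Submodule.smul_mem _ r hy

/-- The submodule `J` as an ideal, for `σ` of order dividing a prime `p` that is zero in `B`. -/
def orbitIdeal (hp : p.Prime) (hpB : (p : B) = 0) (hσ : ∀ x, σ^[p] x = x) :
    Ideal (fixedAlg σ) where
  carrier := orbitSubmodule σ
  add_mem' := fun ha hb => (orbitSubmodule σ).add_mem ha hb
  zero_mem' := (orbitSubmodule σ).zero_mem
  smul_mem' := fun a y hy => by
    have h := fixed_mul_mem hp hpB hσ a 1 y hy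
    rwa [mul_one] at h

/-- `J` is a two-sided ideal. -/
instance (hp : p.Prime) (hpB : (p : B) = 0) (hσ : ∀ x, σ^[p] x = x) :
    (orbitIdeal hp hpB hσ).IsTwoSided where
  mul_mem_of_left := fun {y} b hy => by
    have h := fixed_mul_mem hp hpB hσ 1 b y hy
    rwa [one_mul] at h

end Orbit

/-! ## The datum `A₂` with its involution, and `C₁` -/

/-- The Cartan datum of type `A₂`, with vertices `0` and `1` standing for `1` and `2`. -/
def A2 : CartanDatum (Fin 2) where
  form := fun i j => if i = j then 2 else -1
  symm := by decide
  pos := by decide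
  even := by decide
  nonpos := by decide
  dvd := by decide

/-- The Cartan datum of type `C₁` that is induced from the involution of `A₂`: the only orbit
`η` has two vertices, not orthogonal to each other, so `(α_η, α_η)₁ = 2 · 2 · |η| = 8`
and `d_η = 4`. -/
def C1 : CartanDatum Unit where
  form := fun _ _ => 8
  symm := fun _ _ => rfl
  pos := fun _ => by norm_num
  even := fun _ => by norm_num
  nonpos := fun i j h => absurd (Subsingleton.elim i j) h
  dvd := fun _ _ => by norm_num

theorem swap_isDiagramAut : A2.IsDiagramAut (Equiv.swap 0 1) := by
  unfold CartanDatum.IsDiagramAut A2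
  decide

/-- The automorphism `σ` of `U_q^-(A₂)` over `𝔸'` that interchanges `f_1` and `f_2`. -/
def σA2 : A2.UMod →ₐ[A'] A2.UMod := CartanDatum.sigmaMod swap_isDiagramAut

theorem σA2_iterate (x : A2.UMod) : σA2^[2] x = x :=
  CartanDatum.sigmaMod_iterate swap_isDiagramAut 2 (by decide) x

theorem two_eq_zero : ((2 : ℕ) : A2.UMod) = 0 := by
  have h : ((2 : ℕ) : A') = 0 := by
    have : ((2 : ℕ) : ZMod 2) = 0 := by decide
    rw [← map_natCast (algebraMap (ZMod 2) A'), this, map_zero]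
  rw [← map_natCast (algebraMap A' A2.UMod), h, map_zero]

/-- The ideal `J` for `A₂`. -/
abbrev JA2 : Ideal (fixedAlg σA2) := orbitIdeal Nat.prime_two two_eq_zero σA2_iterate

/-- The `𝔸'`-algebra `V_q`: the `σ`-fixed elements modulo `J`. -/
abbrev Vq : Type := fixedAlg σA2 ⧸ JA2

/-- The projection `π` from the `σ`-fixed elements to `V_q`. -/
def π : fixedAlg σA2 →ₐ[A'] Vq := Ideal.Quotient.mkₐ A' JA2

/-- `f_2^{(a)} f_1^{(2a)} f_2^{(a)}` in the base change of the integral form to `𝔸'`. -/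
def gLift (a : ℕ) : A2.UMod := A2.fmod 1 a * A2.fmod 0 (2 * a) * A2.fmod 1 a

end QFold

end

noncomputable section

namespace QFold

/-! ## Quantum integers and quantum binomial coefficients -/

/-! The integral form of type `A₂` has Lusztig's monomial basis: the `f_i^(a) f_j^(b) f_i^(c)` with
`a + c ≤ b`, where on the wall `b = a + c` the monomial equals `f_j^(c) f_i^(b) f_j^(a)`. So `σ`
permutes the basis: off the wall it exchanges the two vertices, on the wall it exchanges `a` and
`c`. The fixed basis elements are exactly those with `a = c` and `b = 2a`, that is, the `gLift a`.
In characteristic 2 a fixed element is a combination of these plus some `y + σ y`, and every `y + σ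
y` has coordinate zero at each fixed basis element. Hence the `g^(a)` form a basis of `V_q`.

For the product, straightening gives `g · g^(a) = [a+1]_1^4 g^(a+1)` up to a multiple of a sum of
two monomials that `σ` exchanges, and this multiple dies in `V_q`. Modulo 2, the square of Frobenius
turns `[n]_1^4` into `[n]_4`; this is the origin of `d = 4`. Induction gives `[a]_4^! g^(a) = g^a`.
As `V_q` is free over the domain `𝔸'`, factorials may be cancelled, and the `g^(a)` multiply with
the same quantum binomials as the divided powers of `C₁`.

The spanning half of the basis theorem is `monoSpan_eq_top`, obtained from `IsSerrePair.straighten`.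
The independence half is `linearIndependent_coe_basisMono`, obtained from an explicit representation
on PBW coordinates. The wall identity is `IsSerrePair.dp_swap`, and the product formula comes from
`IsSerrePair.dp_palindrome_mul` and `qInt_pow_four`. -/

theorem T_injective (R : Type) [CommRing R] [Nontrivial R] :
    Function.Injective (LaurentPolynomial.T : ℤ → R[T;T⁻¹]) := by
  intro m n h
  have hm := LaurentPolynomial.degree_T (R := R) m
  rw [h, LaurentPolynomial.degree_T] at hm
  exact_mod_cast hm.symm

theorem qInt_ne_zero (R : Type) [CommRing R] [Nontrivial R] {d n : ℕ} (hd : 0 < d) (hn : 0 < n) :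
    qInt R d n ≠ 0 := by
  intro h
  have hs := qInt_spec R d n
  rw [h, mul_zero, eq_comm, sub_eq_zero] at hs
  have h1 := T_injective R hs
  have h2 : (0 : ℤ) < (d : ℤ) * n := by positivity
  omega

theorem qFact_zero (R : Type) [CommRing R] (d : ℕ) : qFact R d 0 = 1 := by simp [qFact]

theorem qFact_succ (R : Type) [CommRing R] (d n : ℕ) :
    qFact R d (n + 1) = qFact R d n * qInt R d (n + 1) := by
  rw [qFact, Finset.prod_range_succ, qFact]

theorem qInt_one (R : Type) [CommRing R] (d : ℕ) : qInt R d 1 = 1 := by simp [qInt]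

theorem qFact_ne_zero (R : Type) [CommRing R] [IsDomain R] {d : ℕ} (hd : 0 < d) (n : ℕ) :
    qFact R d n ≠ 0 :=
  Finset.prod_ne_zero_iff.2 fun _ _ => qInt_ne_zero R hd (Nat.succ_pos _)

theorem qInt_add (R : Type) [CommRing R] (d m n : ℕ) :
    qInt R d (m + n) = LaurentPolynomial.T ((d : ℤ) * n) * qInt R d m
      + LaurentPolynomial.T (-((d : ℤ) * m)) * qInt R d n := by
  rw [qInt, Finset.sum_range_add, qInt, qInt, Finset.mul_sum, Finset.mul_sum]
  congr 1 <;> refine Finset.sum_congr rfl fun k _ => ?_ <;> rw [← LaurentPolynomial.T_add] <;>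
    congr 1 <;> push_cast <;> ring

/-- Quantum binomial coefficients are Laurent polynomials. -/
theorem exists_qBinom (R : Type) [CommRing R] (d : ℕ) : ∀ a b : ℕ,
    ∃ c : R[T;T⁻¹], c * (qFact R d a * qFact R d b) = qFact R d (a + b)
  | 0, b => ⟨1, by rw [qFact_zero, one_mul, one_mul, zero_add]⟩
  | a + 1, 0 => ⟨1, by rw [qFact_zero, one_mul, mul_one, add_zero]⟩
  | a + 1, b + 1 => by
    obtain ⟨c₁, h₁⟩ := exists_qBinom R d a (b + 1)
    obtain ⟨c₂, h₂⟩ := exists_qBinom R d (a + 1) b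
    -- The `q`-Pascal rule, read off from `qInt_add` applied to `[(a+1) + (b+1)]`.
    refine ⟨LaurentPolynomial.T ((d : ℤ) * (b + 1 : ℕ)) * c₁
      + LaurentPolynomial.T (-((d : ℤ) * (a + 1 : ℕ))) * c₂, ?_⟩
    have e : a + 1 + (b + 1) = (a + 1 + b) + 1 := by ring
    rw [e, qFact_succ R d (a + 1 + b), ← e, qInt_add R d (a + 1) (b + 1), mul_add]
    nth_rw 1 [show a + 1 + b = a + (b + 1) by ring]
    rw [← h₁, ← h₂, qFact_succ R d a, qFact_succ R d b]
    ring

/-! ### Reduction modulo 2 and Frobenius -/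

theorem algebraMap_T (m : ℤ) :
    algebraMap A A' (LaurentPolynomial.T m) = LaurentPolynomial.T m := by
  simpa using algebraMap_C_mul_T 1 m

theorem algebraMap_qInt (d n : ℕ) : algebraMap A A' (qInt ℤ d n) = qInt (ZMod 2) d n := by
  simp only [qInt, map_sum, algebraMap_T]

theorem algebraMap_qFact (d n : ℕ) : algebraMap A A' (qFact ℤ d n) = qFact (ZMod 2) d n := by
  simp only [qFact, map_prod, algebraMap_qInt]

instance : CharP A' 2 := charP_of_injective_algebraMap (R := ZMod 2) (A := A')
  (FaithfulSMul.algebraMap_injective _ _) 2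

/-- In characteristic 2 the fourth power is Frobenius applied twice, hence additive, and it sends
`q^k` to `q^(4k)`. -/
theorem qInt_pow_four (n : ℕ) : qInt (ZMod 2) 1 n ^ 4 = qInt (ZMod 2) 4 n := by
  have h : ∀ x : A', x ^ 4 = (frobenius A' 2) ((frobenius A' 2) x) := by
    intro x
    rw [frobenius_def, frobenius_def, ← pow_mul]
  rw [h, qInt, map_sum, map_sum, qInt]
  refine Finset.sum_congr rfl fun k _ => ?_
  rw [frobenius_def, frobenius_def, LaurentPolynomial.T_pow, LaurentPolynomial.T_pow]
  congr 1
  push_cast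
  ring

/-- The indeterminate `q` as an element of `ℚ(q)`. -/
def q : K := algebraMap A K (LaurentPolynomial.T 1)

theorem algebraMap_AK_injective : Function.Injective (algebraMap A K) :=
  IsFractionRing.injective A K

theorem q_ne_zero : q ≠ 0 :=
  ((LaurentPolynomial.isUnit_T 1).map (algebraMap A K)).ne_zero

theorem algebraMap_T_eq_zpow (m : ℤ) : algebraMap A K (LaurentPolynomial.T m) = q ^ m := by
  have h : ∀ n : ℕ, algebraMap A K (LaurentPolynomial.T (n : ℤ)) = q ^ (n : ℤ) := by
    intro n
    rw [q, zpow_natCast, ← map_pow, LaurentPolynomial.T_pow, mul_one]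
  obtain ⟨n, rfl | rfl⟩ := m.eq_nat_or_neg
  · exact h n
  · rw [zpow_neg, ← h]
    refine eq_inv_of_mul_eq_one_left ?_
    rw [← map_mul, ← LaurentPolynomial.T_add, neg_add_cancel, LaurentPolynomial.T_zero, map_one]

theorem q_sub_inv_ne_zero : q - q⁻¹ ≠ 0 := by
  intro h
  have h1 : algebraMap A K (LaurentPolynomial.T 1) = algebraMap A K (LaurentPolynomial.T (-1)) := by
    rw [algebraMap_T_eq_zpow, algebraMap_T_eq_zpow, zpow_one, zpow_neg_one]
    exact sub_eq_zero.1 h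
  have := T_injective ℤ (algebraMap_AK_injective h1)
  omega

/-- The quantum integer `[m]`, `m ∈ ℤ`, as an element of `ℚ(q)`. -/
def br (m : ℤ) : K := (q ^ m - q ^ (-m)) / (q - q⁻¹)

theorem algebraMap_qInt_eq_br (n : ℕ) : algebraMap A K (qInt ℤ 1 n) = br n := by
  rw [br, eq_div_iff q_sub_inv_ne_zero, mul_comm]
  have h := congrArg (algebraMap A K) (qInt_spec ℤ 1 n)
  simpa only [map_mul, map_sub, algebraMap_T_eq_zpow, Nat.cast_one, zpow_one, zpow_neg_one,
    one_mul] using h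

theorem br_zero : br 0 = 0 := by simp [br]

theorem br_one : br 1 = 1 := by
  rw [br, zpow_one, zpow_neg_one, div_self q_sub_inv_ne_zero]

theorem br_two : br 2 = q + q⁻¹ := by
  rw [br, div_eq_iff q_sub_inv_ne_zero, zpow_neg]
  have := q_ne_zero
  field_simp
  ring

theorem br_natCast_succ_ne_zero (n : ℕ) : br ((n : ℤ) + 1) ≠ 0 := by
  have h := algebraMap_qInt_eq_br (n + 1)
  push_cast at h
  rw [← h, Ne, map_eq_zero_iff _ algebraMap_AK_injective]
  exact qInt_ne_zero ℤ one_pos (Nat.succ_pos n)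

theorem br_add (m n : ℤ) : br (m + n) = q ^ n * br m + q ^ (-m) * br n := by
  have := q_sub_inv_ne_zero
  simp only [br, neg_add, zpow_add₀ q_ne_zero]
  field_simp
  ring

theorem br_neg (m : ℤ) : br (-m) = -br m := by
  rw [br, br, neg_neg, ← neg_div, neg_sub]

/-- A three-term identity between products of quantum integers. -/
theorem br_mul_br_add (N j k : ℤ) :
    br (N + 1 + k) * br (j + 1) + br (N - j) * br k = br (j + 1 + k) * br (N + 1) := by
  have := q_sub_inv_ne_zero
  have := q_ne_zero
  simp only [br, neg_add, sub_eq_add_neg, neg_neg, zpow_add₀ q_ne_zero, zpow_neg, zpow_one]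
  have h1 : q ^ N ≠ 0 := zpow_ne_zero _ q_ne_zero
  have h2 : q ^ j ≠ 0 := zpow_ne_zero _ q_ne_zero
  have h3 : q ^ k ≠ 0 := zpow_ne_zero _ q_ne_zero
  generalize q ^ N = x at *
  generalize q ^ j = y at *
  generalize q ^ k = z at *
  field_simp
  ring

/-- The quantum factorial as an element of `ℚ(q)`. -/
def fact (n : ℕ) : K := algebraMap A K (qFact ℤ 1 n)

theorem fact_zero : fact 0 = 1 := by rw [fact, qFact_zero, map_one]

theorem fact_succ (n : ℕ) : fact (n + 1) = fact n * br (n + 1) := by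
  rw [fact, qFact_succ, map_mul, algebraMap_qInt_eq_br, fact]
  push_cast
  rfl

theorem fact_ne_zero (n : ℕ) : fact n ≠ 0 := by
  rw [fact, Ne, map_eq_zero_iff _ algebraMap_AK_injective]
  exact qFact_ne_zero ℤ one_pos n

/-- The quantum binomial coefficient with an integer as its upper entry. -/
def binom (N : ℤ) : ℕ → K
  | 0 => 1
  | j + 1 => binom N j * br (N - j) / br (j + 1)

theorem binom_zero (N : ℤ) : binom N 0 = 1 := rfl

theorem binom_succ (N : ℤ) (j : ℕ) : binom N (j + 1) = binom N j * br (N - j) / br (j + 1) := rfl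

theorem binom_succ_succ (N : ℤ) (j : ℕ) :
    br (j + 1) * binom (N + 1) (j + 1) = br (N + 1) * binom N j := by
  induction j with
  | zero =>
    rw [binom_succ, binom_zero, binom_zero]
    simp [br_one]
  | succ j ih =>
    have h2 := br_natCast_succ_ne_zero j
    have h1 := br_natCast_succ_ne_zero (j + 1)
    rw [binom_succ (N + 1) (j + 1), binom_succ N j, mul_div_cancel₀ _ h1, mul_div_assoc',
      eq_div_iff h2, show N + 1 - ((j + 1 : ℕ) : ℤ) = N - j by push_cast; ring]
    linear_combination br (N - j) * ih

theorem binom_natCast_mul (N j : ℕ) (h : j ≤ N) :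
    binom N j * (fact j * fact (N - j)) = fact N := by
  induction j with
  | zero => rw [binom_zero, fact_zero, one_mul, one_mul, Nat.sub_zero]
  | succ j ih =>
    have h1 := br_natCast_succ_ne_zero j
    rw [← ih (by omega), binom_succ, fact_succ j, show N - j = (N - (j + 1)) + 1 by omega,
      fact_succ (N - (j + 1))]
    rw [show (((N - (j + 1) : ℕ) : ℤ) + 1) = (N : ℤ) - j by omega]
    field_simp

/-- The defining product contains the factor `br 0` as soon as `j` exceeds `N`. -/
theorem binom_natCast_eq_zero (N j : ℕ) (h : N < j) : binom N j = 0 := by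
  induction j with
  | zero => omega
  | succ j ih =>
    rw [binom_succ]
    rcases Nat.lt_or_ge N j with h1 | h1
    · rw [ih h1, zero_mul, zero_div]
    · rw [show N = j by omega, sub_self, br_zero, mul_zero, zero_div]

theorem binom_natCast_mem (N j : ℕ) : ∃ c : A, algebraMap A K c = binom N j := by
  rcases Nat.lt_or_ge N j with h | h
  · exact ⟨0, by rw [map_zero, binom_natCast_eq_zero N j h]⟩
  · obtain ⟨c, hc⟩ := exists_qBinom ℤ 1 j (N - j)
    refine ⟨c, mul_right_cancel₀ (mul_ne_zero (fact_ne_zero j) (fact_ne_zero (N - j))) ?_⟩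
    rw [binom_natCast_mul N j h, fact, fact, fact, ← map_mul, ← map_mul, hc, Nat.add_sub_cancel' h]

theorem binom_step (N : ℤ) (j k : ℕ) :
    binom N j * br (N + 1 + k) + binom N (j + 1) * br k
      = br (j + 1 + k) * binom (N + 1) (j + 1) := by
  have h1 := br_natCast_succ_ne_zero j
  refine mul_left_cancel₀ h1 ?_
  rw [mul_left_comm _ (br _) (binom _ _), binom_succ_succ, binom_succ, mul_add]
  field_simp
  linear_combination binom N j * br_mul_br_add N j k

/-- The coefficients in the straightening rule for divided powers. -/
def coef (N : ℤ) (c k : ℕ) : K := if k ≤ c then binom N (c - k) else 0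

theorem coef_zero_right_step (N : ℤ) (c : ℕ) :
    coef N c 0 * br (N + 1) = br (c + 1) * coef (N + 1) (c + 1) 0 := by
  simp only [coef, Nat.zero_le, if_true, Nat.sub_zero]
  rw [binom_succ_succ, mul_comm]

/-- The recursion in `c` that drives `IsSerrePair.straighten`. After right multiplication by `x`,
the terms of index `k + 1` and `k` both contribute to the new term of index `k + 1`; the factor `br
(c + 1)` comes from `dp_mul`. -/
theorem coef_step (N : ℤ) (c k : ℕ) :
    coef N c (k + 1) * br (N + 1 + (k + 1 : ℕ)) + coef N c k * br (k + 1 : ℕ)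
      = br (c + 1) * coef (N + 1) (c + 1) (k + 1) := by
  rcases lt_trichotomy k c with h | h | h
  · obtain ⟨j, rfl⟩ := Nat.exists_eq_add_of_lt h
    have := binom_step N j (k + 1)
    simp only [coef]
    rw [if_pos (by omega), if_pos (by omega), if_pos (by omega),
      show k + j + 1 - (k + 1) = j by omega, show k + j + 1 - k = j + 1 by omega,
      show k + j + 1 + 1 - (k + 1) = j + 1 by omega, this]
    congr 2
    push_cast
    ring
  · subst h
    simp [coef, binom_zero]
  · simp only [coef]
    rw [if_neg (by omega), if_neg (by omega), if_neg (by omega)]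
    ring

/-! ## Straightening of divided powers -/

section Straighten

variable {B : Type} [Ring B] [Algebra K B]

/-- The quantum Serre relations of type `A₂` for a pair of elements of a `ℚ(q)`-algebra. -/
structure IsSerrePair (x y : B) : Prop where
  left : x * x * y - (q + q⁻¹) • (x * y * x) + y * x * x = 0
  right : y * y * x - (q + q⁻¹) • (y * x * y) + x * y * y = 0

/-- The `q`-commutator of two elements. -/
def qComm (x y : B) : B := x * y - q⁻¹ • (y * x)

theorem IsSerrePair.symm {x y : B} (h : IsSerrePair x y) : IsSerrePair y x := ⟨h.right, h.left⟩

/-- Replaces a cubic Serre relation by `q`-commutation with `z = qComm x y`, which can be iterated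
to move powers past each other. -/
theorem mul_qComm_iff (x y : B) :
    x * qComm x y = q • (qComm x y * x) ↔
      x * x * y - (q + q⁻¹) • (x * y * x) + y * x * x = 0 := by
  rw [← sub_eq_zero]
  have : x * qComm x y - q • (qComm x y * x)
      = x * x * y - (q + q⁻¹) • (x * y * x) + y * x * x := by
    have := q_ne_zero
    simp only [qComm, mul_sub, sub_mul, mul_smul_comm, smul_mul_assoc, smul_sub, smul_smul,
      mul_inv_cancel₀ this, one_smul, ← mul_assoc, add_smul]
    abel
  rw [this]

theorem qComm_mul_iff (x y : B) :
    qComm x y * y = q • (y * qComm x y) ↔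
      y * y * x - (q + q⁻¹) • (y * x * y) + x * y * y = 0 := by
  rw [← sub_eq_zero]
  have : qComm x y * y - q • (y * qComm x y)
      = y * y * x - (q + q⁻¹) • (y * x * y) + x * y * y := by
    have := q_ne_zero
    simp only [qComm, mul_sub, sub_mul, mul_smul_comm, smul_mul_assoc, smul_sub, smul_smul,
      mul_inv_cancel₀ this, one_smul, ← mul_assoc, add_smul]
    abel
  rw [this]

variable {x y : B}

theorem IsSerrePair.pow_mul_qComm (h : IsSerrePair x y) (n : ℕ) :
    x ^ n * qComm x y = q ^ n • (qComm x y * x ^ n) := by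
  induction n with
  | zero => simp
  | succ n ih =>
    rw [pow_succ', mul_assoc, ih, mul_smul_comm, ← mul_assoc, (mul_qComm_iff x y).2 h.left,
      smul_mul_assoc, smul_smul, mul_assoc, pow_succ]

theorem IsSerrePair.qComm_mul_pow (h : IsSerrePair x y) (n : ℕ) :
    qComm x y * y ^ n = q ^ n • (y ^ n * qComm x y) := by
  induction n with
  | zero => simp
  | succ n ih =>
    rw [pow_succ, ← mul_assoc, ih, smul_mul_assoc, mul_assoc, (qComm_mul_iff x y).2 h.right,
      mul_smul_comm, smul_smul, ← mul_assoc, pow_succ]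

theorem mul_eq_add_qComm (x y : B) : x * y = q⁻¹ • (y * x) + qComm x y := by
  rw [qComm, add_sub_cancel]

theorem IsSerrePair.mul_pow_succ (h : IsSerrePair x y) (m : ℕ) :
    x * y ^ (m + 1) = q ^ (-(m + 1 : ℤ)) • (y ^ (m + 1) * x)
      + br (m + 1) • (y ^ m * qComm x y) := by
  induction m with
  | zero => simp [br_one, ← mul_eq_add_qComm]
  | succ m ih =>
    rw [pow_succ, ← mul_assoc, ih, add_mul, smul_mul_assoc, smul_mul_assoc, mul_assoc _ x y,
      mul_eq_add_qComm x y, mul_assoc _ _ y, (qComm_mul_iff x y).2 h.right]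
    simp only [mul_add, mul_smul_comm, smul_add, smul_smul, ← mul_assoc, ← pow_succ]
    rw [show ((m + 1 : ℕ) : ℤ) + 1 = ((m : ℤ) + 1) + 1 by push_cast; ring, br_add (m + 1) 1, br_one,
      neg_add ((m : ℤ) + 1) 1, zpow_add₀ q_ne_zero, zpow_neg_one, zpow_one, mul_one, add_smul, mul_comm q (br _)]
    abel

theorem IsSerrePair.pow_succ_mul (h : IsSerrePair x y) (n : ℕ) :
    x ^ (n + 1) * y = q ^ (-(n + 1 : ℤ)) • (y * x ^ (n + 1))
      + br (n + 1) • (qComm x y * x ^ n) := by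
  induction n with
  | zero => simp [br_one, ← mul_eq_add_qComm]
  | succ n ih =>
    rw [pow_succ', mul_assoc, ih, mul_add, mul_smul_comm, mul_smul_comm, ← mul_assoc x y,
      mul_eq_add_qComm x y, ← mul_assoc x _ (x ^ n), (mul_qComm_iff x y).2 h.left]
    simp only [add_mul, smul_mul_assoc, smul_add, smul_smul, mul_assoc, ← pow_succ']
    rw [show ((n + 1 : ℕ) : ℤ) + 1 = ((n : ℤ) + 1) + 1 by push_cast; ring, br_add (n + 1) 1, br_one,
      neg_add ((n : ℤ) + 1) 1, zpow_add₀ q_ne_zero, zpow_neg_one, zpow_one, mul_one, add_smul, mul_comm q (br _)]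
    abel

/-- With `z = qComm x y`, moving `x` leftwards through `y^(m+1)` and `y` rightwards through
`x^(n+1)` turns both sides into combinations of `x^(n+1) y^(m+1)` and `z x^n y^m`. The coefficients
are compared in `e1` and `e2`, so that no `z` remains in the rule. -/
theorem IsSerrePair.pow_mul_pow_succ_mul (h : IsSerrePair x y) (n m : ℕ) :
    br (n + 1) • (x ^ n * y ^ (m + 1) * x)
      = br (n - m) • (x ^ (n + 1) * y ^ (m + 1)) + br (m + 1) • (y * x ^ (n + 1) * y ^ m) := by
  have hq := q_ne_zero
  have h1 : y ^ (m + 1) * x = q ^ (m + 1 : ℤ) • (x * y ^ (m + 1))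
      - (q ^ (m + 1 : ℤ) * br (m + 1)) • (y ^ m * qComm x y) := by
    rw [h.mul_pow_succ m, smul_add, smul_smul, smul_smul, ← zpow_add₀ hq, add_neg_cancel,
      zpow_zero, one_smul, add_sub_cancel_right]
  have h2 : y * x ^ (n + 1) = q ^ (n + 1 : ℤ) • (x ^ (n + 1) * y)
      - (q ^ (n + 1 : ℤ) * br (n + 1)) • (qComm x y * x ^ n) := by
    rw [h.pow_succ_mul n, smul_add, smul_smul, smul_smul, ← zpow_add₀ hq, add_neg_cancel,
      zpow_zero, one_smul, add_sub_cancel_right]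
  have h3 : x ^ n * (y ^ m * qComm x y) = q ^ (n - m : ℤ) • (qComm x y * x ^ n * y ^ m) := by
    have h4 : y ^ m * qComm x y = q ^ (-m : ℤ) • (qComm x y * y ^ m) := by
      rw [h.qComm_mul_pow, smul_smul, ← zpow_natCast, ← zpow_add₀ hq, neg_add_cancel, zpow_zero,
        one_smul]
    rw [h4, mul_smul_comm, ← mul_assoc, h.pow_mul_qComm, smul_mul_assoc, smul_smul, ← zpow_natCast,
      ← zpow_add₀ hq, neg_add_eq_sub]
  have h5 : x ^ n * (x * y ^ (m + 1)) = x ^ (n + 1) * y ^ (m + 1) := by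
    rw [← mul_assoc, ← pow_succ]
  have h6 : x ^ (n + 1) * y * y ^ m = x ^ (n + 1) * y ^ (m + 1) := by
    rw [mul_assoc, ← pow_succ']
  rw [mul_assoc, h1, h2]
  simp only [mul_sub, sub_mul, mul_smul_comm, smul_mul_assoc, h3, h5, h6, smul_sub, smul_smul]
  have e1 : br (n + 1) * q ^ (m + 1 : ℤ) = br (n - m) + br (m + 1) * q ^ (n + 1 : ℤ) := by
    have := br_add (-(m + 1)) (n + 1)
    rw [br_neg, neg_neg, show (-(m + 1) + (n + 1) : ℤ) = n - m by ring] at this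
    rw [this]
    ring
  have e2 : br (n + 1) * (q ^ (m + 1 : ℤ) * br (m + 1) * q ^ (n - m : ℤ))
      = br (m + 1) * (q ^ (n + 1 : ℤ) * br (n + 1)) := by
    have : q ^ (n + 1 : ℤ) = q ^ (m + 1 : ℤ) * q ^ (n - m : ℤ) := by
      rw [← zpow_add₀ hq]
      congr 1
      ring
    rw [this]
    ring
  rw [e1, e2, add_smul]
  abel

/-- The divided power `x ^ n / [n]!`. -/
def dp (x : B) (n : ℕ) : B := (fact n)⁻¹ • x ^ n

theorem dp_zero (x : B) : dp x 0 = 1 := by rw [dp, fact_zero, inv_one, one_smul, pow_zero]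

theorem dp_one (x : B) : dp x 1 = x := by
  rw [dp, fact_succ, fact_zero, Nat.cast_zero, zero_add, br_one, mul_one, inv_one, one_smul,
    pow_one]

theorem fact_smul_dp (x : B) (n : ℕ) : fact n • dp x n = x ^ n := by
  rw [dp, smul_smul, mul_inv_cancel₀ (fact_ne_zero n), one_smul]

theorem mul_dp (x : B) (n : ℕ) : x * dp x n = br (n + 1) • dp x (n + 1) := by
  rw [dp, dp, fact_succ, mul_smul_comm, ← pow_succ', smul_smul, mul_inv_rev, ← mul_assoc,
    mul_inv_cancel₀ (br_natCast_succ_ne_zero n), one_mul]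

theorem dp_mul (x : B) (n : ℕ) : dp x n * x = br (n + 1) • dp x (n + 1) := by
  rw [← mul_dp, dp, smul_mul_assoc, mul_smul_comm, ← pow_succ, ← pow_succ']

theorem dp_mul_dp (x : B) (m n : ℕ) :
    dp x m * dp x n = (fact (m + n) / (fact m * fact n)) • dp x (m + n) := by
  rw [dp, dp, dp, smul_mul_smul_comm, ← pow_add, smul_smul]
  congr 1
  have := fact_ne_zero (m + n)
  have := fact_ne_zero m
  have := fact_ne_zero n
  field_simp

/-- The case `c = 1` of the straightening rule, from which the general case follows by induction on
`c`. -/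
theorem IsSerrePair.dp_mul_dp_succ_mul (h : IsSerrePair x y) (n m : ℕ) :
    dp x n * dp y (m + 1) * x
      = br (n + 1 - (m + 1 : ℕ)) • (dp x (n + 1) * dp y (m + 1))
        + y * dp x (n + 1) * dp y m := by
  have h0 := h.pow_mul_pow_succ_mul n m
  have hn := fact_ne_zero n
  have hm := fact_ne_zero m
  have bn := br_natCast_succ_ne_zero n
  have bm := br_natCast_succ_ne_zero m
  simp only [← fact_smul_dp, smul_mul_assoc, mul_smul_comm, smul_smul] at h0
  have h1 := congrArg (fun t => (fact (n + 1) * fact (m + 1))⁻¹ • t) h0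
  simp only [smul_add, smul_smul, fact_succ] at h1
  rw [show (n + 1 - (m + 1 : ℕ) : ℤ) = n - m by push_cast; ring]
  convert h1 using 2
  · rw [show (fact n * br (n + 1) * (fact m * br (m + 1)))⁻¹ *
      (br (n + 1) * (fact m * br (m + 1) * fact n)) = 1 by field_simp, one_smul]
  · congr 1
    field_simp
  · rw [show (fact n * br (n + 1) * (fact m * br (m + 1)))⁻¹ *
      (br (m + 1) * (fact m * (fact n * br (n + 1)))) = 1 by field_simp, one_smul]

/-- The straightening rule for a product `x^(a) y^(b) x^(c)` of divided powers. -/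
theorem IsSerrePair.straighten (h : IsSerrePair x y) (a b c : ℕ) :
    dp x a * dp y b * dp x c
      = ∑ k ∈ Finset.range (b + 1),
        coef (a + c - b) c k • (dp y k * dp x (a + c) * dp y (b - k)) := by
  induction c with
  | zero =>
    rw [Finset.sum_eq_single_of_mem 0 (by simp)]
    · simp [coef, binom_zero, dp_zero]
    · intro k _ hk
      rw [coef, if_neg (by omega), zero_smul]
  | succ c ih =>
    have bc := br_natCast_succ_ne_zero c
    have h0 : br (c + 1) • (dp x a * dp y b * dp x (c + 1)) = dp x a * dp y b * dp x c * x := by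
      rw [mul_assoc _ (dp x c) x, dp_mul, mul_smul_comm]
    have h1 : ∀ u v : B, br (c + 1) • u = br (c + 1) • v → u = v := by
      intro u v huv
      have := congrArg (fun t => (br (c + 1))⁻¹ • t) huv
      simpa only [smul_smul, inv_mul_cancel₀ bc, one_smul] using this
    apply h1
    set n := a + c with hn
    -- For `k < b` a factor `y` remains on the right, and the case `c = 1` splits the product with
    -- `x` into terms of index `k` and `k + 1`.
    have hR : ∀ k ∈ Finset.range b,
        coef (a + c - b) c k • (dp y k * dp x n * dp y (b - k)) * x
          = (coef (a + c - b) c k * br (a + c - b + 1 + k)) •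
              (dp y k * dp x (n + 1) * dp y (b - k))
            + (coef (a + c - b) c k * br (k + 1 : ℕ)) •
              (dp y (k + 1) * dp x (n + 1) * dp y (b - (k + 1))) := by
      intro k hk
      obtain ⟨m, hm⟩ := Nat.exists_eq_add_of_lt (Finset.mem_range.1 hk)
      have e1 : b - k = m + 1 := by omega
      have e2 : b - (k + 1) = m := by omega
      have e3 : (a + c - b + 1 + k : ℤ) = n + 1 - (m + 1 : ℕ) := by omega
      rw [e1, e2, e3, smul_mul_assoc, mul_assoc (dp y k), mul_assoc (dp y k),
        h.dp_mul_dp_succ_mul, mul_add, mul_smul_comm, smul_add, smul_smul, mul_assoc (dp y k),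
        mul_assoc y, ← mul_assoc (dp y k) y, dp_mul, smul_mul_assoc, smul_smul, Nat.cast_add_one k,
        mul_assoc (dp y (k + 1))]
    -- For `k = b` no `y` remains on the right, so `x` merges with its divided power and only one
    -- term arises.
    have hb : coef (a + c - b) c b • (dp y b * dp x n * dp y (b - b)) * x
          = (coef (a + c - b) c b * br (a + c - b + 1 + b)) •
              (dp y b * dp x (n + 1) * dp y (b - b)) := by
      rw [Nat.sub_self, dp_zero, mul_one, mul_one, smul_mul_assoc, mul_assoc, dp_mul,
        mul_smul_comm, smul_smul]
      congr 3
      rw [hn]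
      push_cast
      ring
    have e4 : (a + (c + 1 : ℕ) - b : ℤ) = a + c - b + 1 := by push_cast; ring
    -- The terms of unchanged index run over `0, …, b` and those of raised index over `1, …, b`;
    -- index `0` is split off and the others are paired for `coef_step`.
    rw [h0, ih, Finset.sum_mul, Finset.sum_range_succ, Finset.sum_congr rfl hR, hb,
      Finset.sum_add_distrib, add_right_comm,
      ← Finset.sum_range_succ (fun k => (coef (a + c - b) c k * br (a + c - b + 1 + k)) •
              (dp y k * dp x (n + 1) * dp y (b - k))),
      Finset.sum_range_succ', add_right_comm, ← Finset.sum_add_distrib, Finset.smul_sum,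
      Finset.sum_range_succ' (fun k => br (c + 1) • _ • _), e4, ← add_assoc a c 1]
    congr 1
    · refine Finset.sum_congr rfl fun k _ => ?_
      rw [← add_smul, coef_step, smul_smul]
    · rw [Nat.cast_zero, add_zero, coef_zero_right_step, smul_smul]

/-- `x^(a) y^(a + c) x^(c) = y^(c) x^(a + c) y^(a)`. -/
theorem IsSerrePair.dp_swap (h : IsSerrePair x y) (a c : ℕ) :
    dp x a * dp y (a + c) * dp x c = dp y c * dp x (a + c) * dp y a := by
  -- Here the upper entry of the binomials is `0`, so only the term with `c - k = 0` survives.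
  rw [h.straighten, Finset.sum_eq_single_of_mem c (by simp)]
  · simp [coef, binom_zero]
  · intro k _ hk
    have e : ((a : ℤ) + c - (a + c : ℕ)) = (0 : ℕ) := by push_cast; ring
    rw [coef]
    split_ifs with hkc
    · rw [e, binom_natCast_eq_zero 0 (c - k) (by omega), zero_smul]
    · rw [zero_smul]

theorem coef_integral (N c k : ℕ) : ∃ u : A, algebraMap A K u = coef N c k := by
  rw [coef]
  split_ifs
  · exact binom_natCast_mem N (c - k)
  · exact ⟨0, map_zero _⟩

/-- The condition `b ≤ a + c` makes the upper entry of the binomials a natural number, so they are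
Laurent polynomials. -/
theorem IsSerrePair.straighten_integral (h : IsSerrePair x y) (a b c : ℕ) (hb : b ≤ a + c) :
    ∃ u : ℕ → A, dp x a * dp y b * dp x c
      = ∑ k ∈ Finset.range (b + 1),
        algebraMap A K (u k) • (dp y k * dp x (a + c) * dp y (b - k)) := by
  choose u hu using coef_integral (a + c - b) c
  refine ⟨u, ?_⟩
  rw [h.straighten]
  refine Finset.sum_congr rfl fun k _ => ?_
  rw [hu, show ((a : ℤ) + c - b) = (a + c - b : ℕ) by omega]

/-- The product of `y x^(2) y` and `y^(a) x^(2a) y^(a)` for `a = m + 1`. -/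
theorem IsSerrePair.dp_palindrome_mul (h : IsSerrePair x y) (m : ℕ) :
    ∃ u : A, (dp y 1 * dp x 2 * dp y 1) * (dp y (m + 1) * dp x (2 * (m + 1)) * dp y (m + 1))
      = algebraMap A K (qInt ℤ 1 (m + 2) ^ 4) • (dp y (m + 2) * dp x (2 * (m + 2)) * dp y (m + 2))
        + algebraMap A K u • (dp y (m + 3) * dp x (2 * (m + 2)) * dp y (m + 1)
          + dp y (m + 1) * dp x (2 * (m + 2)) * dp y (m + 3)) := by
  obtain ⟨β, hβ⟩ := binom_natCast_mem (m + 2) m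
  -- The common coefficient of the two outer terms: `[m+2]` from merging the adjacent powers of `y`,
  -- `β` from straightening, `[m+3]` from `y * dp y (m + 2)`.
  refine ⟨qInt ℤ 1 (m + 2) * (β * qInt ℤ 1 (m + 3)), ?_⟩
  simp only [map_mul, map_pow, algebraMap_qInt_eq_br, hβ]
  have hN : (((2 : ℕ) : ℤ) + (2 * (m + 1) : ℕ) - (m + 2 : ℕ)) = (m + 2 : ℕ) := by push_cast; ring
  -- The coefficients are binomials with entries `m + 2` and `2(m + 1) - k`; they vanish for `k <
  -- m`, which leaves three terms.
  have h1 : dp x 2 * dp y (m + 2) * dp x (2 * (m + 1))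
      = dp y m * dp x (2 * (m + 2)) * dp y 2
        + br (m + 2 : ℕ) • (dp y (m + 1) * dp x (2 * (m + 2)) * dp y 1)
        + binom (m + 2 : ℕ) m • (dp y (m + 2) * dp x (2 * (m + 2)) * dp y 0) := by
    rw [h.straighten, hN, Finset.sum_range_succ, Finset.sum_range_succ, Finset.sum_range_succ,
      Finset.sum_eq_zero, zero_add]
    · have b1 : binom (m + 2 : ℕ) (m + 2) = 1 := by
        have := binom_natCast_mul (m + 2) (m + 2) le_rfl
        rw [Nat.sub_self, fact_zero, mul_one] at this
        exact (mul_eq_right₀ (fact_ne_zero _)).1 this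
      have b2 : binom (m + 2 : ℕ) (m + 1) = br (m + 2 : ℕ) := by
        have := binom_natCast_mul (m + 2) (m + 1) (by omega)
        rw [show m + 2 - (m + 1) = 0 + 1 by omega, fact_succ 0, fact_zero, Nat.cast_zero, zero_add,
          br_one, mul_one, mul_one, fact_succ (m + 1), mul_comm] at this
        rw [mul_left_cancel₀ (fact_ne_zero _) this]
        congr 1
      simp only [coef]
      rw [if_pos (by omega), if_pos (by omega), if_pos (by omega),
        show 2 * (m + 1) - m = m + 2 by omega, show 2 * (m + 1) - (m + 1) = m + 1 by omega,
        show 2 * (m + 1) - (m + 2) = m by omega, b1, b2, one_smul, Nat.sub_self,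
        show m + 2 - m = 2 by omega, show m + 2 - (m + 1) = 1 by omega,
        show 2 + 2 * (m + 1) = 2 * (m + 2) by ring]
    · intro k hk
      have := Finset.mem_range.1 hk
      rw [coef, if_pos (by omega), binom_natCast_eq_zero _ _ (by omega), zero_smul]
  have h2 : (dp y 1 * dp x 2 * dp y 1) * (dp y (m + 1) * dp x (2 * (m + 1)) * dp y (m + 1))
      = br (m + 2 : ℕ) • (y * (dp x 2 * dp y (m + 2) * dp x (2 * (m + 1))) * dp y (m + 1)) := by
    have : dp y 1 * dp y (m + 1) = br (m + 2 : ℕ) • dp y (m + 2) := by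
      rw [dp_one, mul_dp]
      rfl
    calc _ = dp y 1 * dp x 2 * (dp y 1 * dp y (m + 1)) * dp x (2 * (m + 1)) * dp y (m + 1) := by
          simp only [mul_assoc]
      _ = _ := by
          rw [this, dp_one]
          simp only [mul_smul_comm, smul_mul_assoc, mul_assoc]
  have f0 : y * dp y m = br (m + 1 : ℕ) • dp y (m + 1) := mul_dp y m
  have f1 : y * dp y (m + 1) = br (m + 2 : ℕ) • dp y (m + 2) := mul_dp y (m + 1)
  have f2 : y * dp y (m + 2) = br (m + 3 : ℕ) • dp y (m + 3) := mul_dp y (m + 2)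
  have g2 : dp y 2 * dp y (m + 1) = (fact (m + 3) / (fact 2 * fact (m + 1))) • dp y (m + 3) := by
    rw [dp_mul_dp, show 2 + (m + 1) = m + 3 by ring]
  have g1 : dp y 1 * dp y (m + 1) = br (m + 2 : ℕ) • dp y (m + 2) := by rw [dp_one, f1]
  -- The two outer coefficients agree. This equality is what makes the remainder an orbit sum.
  have hc : br (m + 1 : ℕ) * (fact (m + 3) / (fact 2 * fact (m + 1)))
      = binom (m + 2 : ℕ) m * br (m + 3 : ℕ) := by
    have b := binom_natCast_mul (m + 2) m (by omega)
    rw [show m + 2 - m = 2 by omega] at b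
    have e1 : fact (m + 3) = fact (m + 2) * br (m + 3 : ℕ) := fact_succ (m + 2)
    have e2 : fact (m + 1) = fact m * br (m + 1 : ℕ) := fact_succ m
    have n1 := fact_ne_zero 2
    have n2 := fact_ne_zero (m + 1)
    rw [mul_div_assoc', div_eq_iff (mul_ne_zero n1 n2), e1, e2, ← b]
    ring
  have expand : ∀ (A₁ A₂ A₃ C D₁ D₂ D₃ E : B) (r s : K),
      y * (A₁ * C * D₁ + r • (A₂ * C * D₂) + s • (A₃ * C * D₃)) * E
        = (y * A₁) * C * (D₁ * E) + r • ((y * A₂) * C * (D₂ * E))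
          + s • ((y * A₃) * C * (D₃ * E)) := by
    intros
    simp only [mul_add, add_mul, mul_smul_comm, smul_mul_assoc, mul_assoc]
  rw [h2, h1, expand, f0, f1, f2, g1, g2, dp_zero, one_mul]
  simp only [smul_mul_assoc, mul_smul_comm, smul_smul, smul_add]
  rw [mul_comm (fact (m + 3) / _), hc]
  have e4 : br (m + 2 : ℕ) * (br (m + 2 : ℕ) * (br (m + 2 : ℕ) * br (m + 2 : ℕ)))
      = br (m + 2 : ℕ) ^ 4 := by ring
  simp only [mul_assoc, e4]
  abel

end Straighten

/-! ## A spanning set of the integral form in type `A₂` -/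

theorem A2_d (i : Fin 2) : A2.d i = 1 := by simp [CartanDatum.d, A2]

theorem A2_serreExp {i j : Fin 2} (h : i ≠ j) : A2.serreExp i j = 2 := by
  simp [CartanDatum.serreExp, A2, h]

theorem fdiv_eq_dp (i : Fin 2) (n : ℕ) : A2.fdiv i n = dp (A2.f i) n := by
  rw [CartanDatum.fdiv, A2_d]
  rfl

theorem fact_two : fact 2 = q + q⁻¹ := by
  rw [fact_succ, fact_succ, fact_zero, ← br_two]
  simp [br_one]

theorem q_add_inv_ne_zero : q + q⁻¹ ≠ 0 := fact_two ▸ fact_ne_zero 2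

/-- The Serre relation of type `A₂` in terms of divided powers. -/
theorem serre_sum_eq {B : Type} [Ring B] [Algebra K B] (x y : B) :
    (q + q⁻¹) • ∑ k ∈ Finset.range 3, (-1) ^ k * divPow 1 x k * y * divPow 1 x (2 - k)
      = x * x * y - (q + q⁻¹) • (x * y * x) + y * x * x := by
  change (q + q⁻¹) • ∑ k ∈ Finset.range 3, (-1) ^ k * dp x k * y * dp x (2 - k) = _
  have h2 : dp x 2 = (q + q⁻¹)⁻¹ • (x * x) := by rw [dp, fact_two, sq]
  have := q_add_inv_ne_zero
  simp only [Finset.sum_range_succ, Finset.range_zero, Finset.sum_empty, zero_add, pow_zero, one_mul,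
    pow_one, neg_mul, Nat.sub_zero, Nat.sub_self, even_two.neg_pow, one_pow, dp_zero, dp_one,
    mul_one, h2, smul_add, smul_neg, smul_mul_assoc, mul_smul_comm, smul_smul,
    mul_inv_cancel₀ this, one_smul, Nat.reduceSub, mul_assoc]
  abel

theorem A2_serre {i j : Fin 2} (h : i ≠ j) :
    A2.f i * A2.f i * A2.f j - (q + q⁻¹) • (A2.f i * A2.f j * A2.f i)
      + A2.f j * A2.f i * A2.f i = 0 := by
  have h1 := A2.mkU_rel (CartanDatum.SerreRel.serre i j h)
  rw [A2_serreExp h, A2_d] at h1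
  simp only [map_sum, map_mul, map_pow, map_neg, map_one, map_zero, CartanDatum.map_divPow] at h1
  rw [← serre_sum_eq]
  change (q + q⁻¹) • ∑ k ∈ Finset.range (2 + 1), (-1) ^ k * divPow 1 (A2.f i) k * A2.f j
    * divPow 1 (A2.f i) (2 - k) = 0
  exact (congrArg _ h1).trans (smul_zero _)

theorem isSerrePair_f {i j : Fin 2} (h : i ≠ j) : IsSerrePair (A2.f i) (A2.f j) :=
  ⟨A2_serre h, A2_serre h.symm⟩

/-- The other vertex of the diagram `A₂`. -/
abbrev opp (i : Fin 2) : Fin 2 := Equiv.swap 0 1 i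

theorem opp_ne (i : Fin 2) : i ≠ opp i := by revert i; decide

theorem opp_opp (i : Fin 2) : opp (opp i) = i := Equiv.swap_apply_self ..

theorem eq_or_eq_opp (i j : Fin 2) : j = i ∨ j = opp i := by revert i j; decide

/-- The monomial `f_i^(a) f_j^(b) f_i^(c)`, where `j ≠ i`, in the integral form. -/
def mono (i : Fin 2) (a b c : ℕ) : A2.intForm := A2.fint i a * A2.fint (opp i) b * A2.fint i c

theorem coe_fint (i : Fin 2) (n : ℕ) : (A2.fint i n : A2.U) = dp (A2.f i) n := fdiv_eq_dp i n

theorem coe_mono (i : Fin 2) (a b c : ℕ) :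
    (mono i a b c : A2.U) = dp (A2.f i) a * dp (A2.f (opp i)) b * dp (A2.f i) c := by
  rw [← coe_fint, ← coe_fint, ← coe_fint]
  rfl

theorem mono_swap (i : Fin 2) (a c : ℕ) : mono i a (a + c) c = mono (opp i) c (a + c) a := by
  apply Subtype.ext
  rw [coe_mono, coe_mono, opp_opp]
  exact (isSerrePair_f (opp_ne i)).dp_swap a c

theorem fint_mul_fint_eq_smul {I : Type} (X : CartanDatum I) (i : I) (hd : 0 < X.d i) {m n : ℕ}
    {u : A} (hu : u * (qFact ℤ (X.d i) m * qFact ℤ (X.d i) n) = qFact ℤ (X.d i) (m + n)) :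
    X.fint i m * X.fint i n = u • X.fint i (m + n) := by
  have h : ∀ k, algebraMap A K (qFact ℤ (X.d i) k) ≠ 0 := fun k => by
    rw [Ne, map_eq_zero_iff _ algebraMap_AK_injective]
    exact qFact_ne_zero ℤ hd k
  apply Subtype.ext
  change X.fdiv i m * X.fdiv i n = u • X.fdiv i (m + n)
  rw [CartanDatum.fdiv, CartanDatum.fdiv, CartanDatum.fdiv, divPow, divPow, divPow,
    smul_mul_smul_comm, ← pow_add, ← algebraMap_smul K u, smul_smul, ← hu, map_mul, map_mul]
  congr 1
  have h1 := h (m + n)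
  rw [← hu, map_mul, map_mul] at h1
  have h2 := left_ne_zero_of_mul h1
  have h3 := h m
  have h4 := h n
  field_simp

theorem fint_mul_fint (i : Fin 2) (m n : ℕ) :
    ∃ u : A, A2.fint i m * A2.fint i n = u • A2.fint i (m + n) := by
  obtain ⟨u, hu⟩ := exists_qBinom ℤ (A2.d i) m n
  exact ⟨u, fint_mul_fint_eq_smul A2 i (by rw [A2_d]; exact one_pos) hu⟩

theorem mono_straighten (i : Fin 2) (a b c : ℕ) (hb : b ≤ a + c) :
    ∃ u : ℕ → A, mono i a b c
      = ∑ k ∈ Finset.range (b + 1), u k • mono (opp i) k (a + c) (b - k) := by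
  obtain ⟨u, hu⟩ := (isSerrePair_f (opp_ne i)).straighten_integral a b c hb
  refine ⟨u, Subtype.ext ?_⟩
  rw [coe_mono, hu, AddSubmonoidClass.coe_finsetSum]
  refine Finset.sum_congr rfl fun k _ => ?_
  rw [algebraMap_smul, SetLike.val_smul, coe_mono, opp_opp]

/-- The `𝔸`-span of the monomials `f_i^(a) f_j^(b) f_i^(c)` with `a + c ≤ b`. -/
def monoSpan : Submodule A A2.intForm :=
  Submodule.span A {u | ∃ i a b c, a + c ≤ b ∧ u = mono i a b c}

/-- If `b ≤ a + c`, straightening produces middle exponent `a + c` and outer exponents with sum `b`,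
so the inequality is reversed. -/
theorem mono_mem_monoSpan (i : Fin 2) (a b c : ℕ) : mono i a b c ∈ monoSpan := by
  rcases le_total (a + c) b with h | h
  · exact Submodule.subset_span ⟨i, a, b, c, h, rfl⟩
  · obtain ⟨u, hu⟩ := mono_straighten i a b c h
    rw [hu]
    refine Submodule.sum_mem _ fun k hk => Submodule.smul_mem _ _ (Submodule.subset_span
      ⟨_, _, _, _, ?_, rfl⟩)
    have := Finset.mem_range.1 hk
    omega

/-- If the vertices agree, the first two divided powers merge. Otherwise the product has four
alternating factors; `a ≤ n + b` allows the first three to be straightened, and the last factor then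
merges. -/
theorem fint_mul_mono_mem (i j : Fin 2) (n a b c : ℕ) (h : a + c ≤ b) :
    A2.fint i n * mono j a b c ∈ monoSpan := by
  rcases eq_or_eq_opp i j with rfl | rfl
  · obtain ⟨u, hu⟩ := fint_mul_fint j n a
    rw [mono, ← mul_assoc, ← mul_assoc, hu, smul_mul_assoc, smul_mul_assoc]
    exact Submodule.smul_mem _ _ (mono_mem_monoSpan j (n + a) b c)
  · obtain ⟨u, hu⟩ := mono_straighten i n a b (by omega)
    have e : A2.fint i n * mono (opp i) a b c = mono i n a b * A2.fint (opp i) c := by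
      simp only [mono, opp_opp, mul_assoc]
    rw [e, hu, Finset.sum_mul]
    refine Submodule.sum_mem _ fun k hk => ?_
    obtain ⟨v, hv⟩ := fint_mul_fint (opp i) (a - k) c
    rw [smul_mul_assoc, mono, mul_assoc, hv, mul_smul_comm]
    exact Submodule.smul_mem _ _ (Submodule.smul_mem _ _ (mono_mem_monoSpan _ _ _ _))

theorem fint_zero {I : Type} (X : CartanDatum I) (i : I) : X.fint i 0 = 1 := by
  apply Subtype.ext
  change divPow (X.d i) (X.f i) 0 = 1
  rw [divPow, qFact_zero, map_one, inv_one, one_smul, pow_zero]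

/-- A submodule of the integral form that contains `1` and is stable under left multiplication by
the divided powers of the generators is everything. -/
theorem eq_top_of_fint_mul_mem {I : Type} (X : CartanDatum I) (S : Submodule A X.intForm)
    (h1 : 1 ∈ S) (hS : ∀ i n, ∀ v ∈ S, X.fint i n * v ∈ S) : S = ⊤ := by
  have key : ∀ (x : X.U) (hx : x ∈ X.intForm), ∀ v ∈ S, (⟨x, hx⟩ : X.intForm) * v ∈ S := by
    intro x hx
    refine Algebra.adjoin_induction (p := fun x hx => ∀ v ∈ S,
      (⟨x, hx⟩ : X.intForm) * v ∈ S) ?_ ?_ ?_ ?_ hx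
    · rintro _ ⟨⟨i, n⟩, rfl⟩ v hv
      exact hS i n v hv
    · intro r v hv
      have : (⟨algebraMap A X.U r, Subalgebra.algebraMap_mem _ r⟩ : X.intForm) * v = r • v := by
        rw [Algebra.smul_def]
        rfl
      exact this ▸ Submodule.smul_mem _ _ hv
    · intro x y hx hy h1 h2 v hv
      have := Submodule.add_mem _ (h1 v hv) (h2 v hv)
      rwa [← add_mul] at this
    · intro x y hx hy h1 h2 v hv
      have := h1 _ (h2 v hv)
      rwa [← mul_assoc] at this
  refine Submodule.eq_top_iff'.2 fun x => ?_
  have := key x.1 x.2 1 h1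
  rwa [mul_one] at this

theorem monoSpan_eq_top : monoSpan = ⊤ := by
  refine eq_top_of_fint_mul_mem A2 _ ?_ ?_
  · have := mono_mem_monoSpan 0 0 0 0
    rwa [mono, fint_zero, fint_zero, mul_one, mul_one] at this
  · intro i n v hv
    refine Submodule.span_induction (p := fun v _ => A2.fint i n * v ∈ monoSpan) ?_ ?_ ?_ ?_ hv
    · rintro _ ⟨j, a, b, c, h, rfl⟩
      exact fint_mul_mono_mem i j n a b c h
    · rw [mul_zero]
      exact Submodule.zero_mem _
    · intro u v _ _ hu hv
      rw [mul_add]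
      exact Submodule.add_mem _ hu hv
    · intro r u _ hu
      rw [mul_smul_comm]
      exact Submodule.smul_mem _ _ hu

/-! ## A representation of `U_q^-(A₂)` and the linear independence of the monomials -/

/-- The space of functions on `ℕ³`, the coordinates of which correspond to the PBW monomials
`f_2^c z^b f_1^a`. -/
abbrev PBW : Type := ℕ → ℕ → ℕ → K

/-- Left multiplication by `f_1` in PBW coordinates. -/
def opX : Module.End K PBW where
  toFun v c b a := (match a with
    | 0 => 0
    | a + 1 => q ^ ((b : ℤ) - c) * v c b a) + (match b with
    | 0 => 0
    | b + 1 => br (c + 1) * v (c + 1) b a)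
  map_add' v w := by
    funext c b a
    cases a <;> cases b <;> simp only [Pi.add_apply] <;> ring
  map_smul' r v := by
    funext c b a
    cases a <;> cases b <;> simp only [Pi.smul_apply, smul_eq_mul, RingHom.id_apply] <;> ring

/-- Left multiplication by `f_2` in PBW coordinates. -/
def opY : Module.End K PBW where
  toFun v c b a := match c with
    | 0 => 0
    | c + 1 => v c b a
  map_add' v w := by
    funext c b a
    cases c <;> simp only [Pi.add_apply, add_zero]
  map_smul' r v := by
    funext c b a
    cases c <;> simp only [Pi.smul_apply, smul_eq_mul, mul_zero, RingHom.id_apply]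

theorem opX_zero_zero (v : PBW) (c : ℕ) : opX v c 0 0 = 0 := add_zero 0

theorem opX_zero_succ (v : PBW) (c a : ℕ) :
    opX v c 0 (a + 1) = q ^ (-(c : ℤ)) * v c 0 a := by
  simp [opX]

theorem opX_succ_zero (v : PBW) (c b : ℕ) :
    opX v c (b + 1) 0 = br (c + 1) * v (c + 1) b 0 := zero_add _

theorem opX_succ_succ (v : PBW) (c b a : ℕ) :
    opX v c (b + 1) (a + 1) = q ^ ((b : ℤ) + 1 - c) * v c (b + 1) a
      + br (c + 1) * v (c + 1) b (a + 1) := by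
  simp [opX]

theorem opY_zero (v : PBW) (b a : ℕ) : opY v 0 b a = 0 := rfl

theorem opY_succ (v : PBW) (c b a : ℕ) : opY v (c + 1) b a = v c b a := rfl

theorem br_succ_sub (c : ℤ) : br (c + 1) - q⁻¹ * br c = q ^ c := by
  rw [add_comm, br_add, br_one, zpow_neg_one]
  ring

/-- This and `qComm_op_succ` say that the `q`-commutator of the operators acts as left
multiplication by `z`, according to `z f_2^c = q^c f_2^c z`. The Serre relations can then be checked
coordinatewise through `mul_qComm_iff` and `qComm_mul_iff`. -/
theorem qComm_op_zero (v : PBW) (c a : ℕ) : qComm opX opY v c 0 a = 0 := by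
  have hq := q_ne_zero
  change opX (opY v) c 0 a - q⁻¹ * opY (opX v) c 0 a = 0
  cases a <;> cases c <;>
    simp only [opX_zero_zero, opX_zero_succ, opY_zero, opY_succ, mul_zero, sub_zero]
  rw [← mul_assoc, ← zpow_neg_one, ← zpow_add₀ hq, sub_eq_zero]
  congr 2
  push_cast
  ring

theorem qComm_op_succ (v : PBW) (c b a : ℕ) :
    qComm opX opY v c (b + 1) a = q ^ (c : ℤ) * v c b a := by
  have hq := q_ne_zero
  change opX (opY v) c (b + 1) a - q⁻¹ * opY (opX v) c (b + 1) a = _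
  cases a <;> cases c <;>
    simp only [opX_succ_zero, opX_succ_succ, opY_zero, opY_succ, mul_zero, sub_zero, zero_add,
      Nat.cast_zero, br_one, zpow_zero]
  · rw [← br_succ_sub]
    push_cast
    ring
  · have (c : ℕ) : q ^ ((b : ℤ) + 1 - (c + 1 : ℕ)) = q⁻¹ * q ^ ((b : ℤ) + 1 - c) := by
      rw [← zpow_neg_one, ← zpow_add₀ hq]
      congr 1
      push_cast
      ring
    rw [this, ← br_succ_sub ((_ + 1 : ℕ) : ℤ)]
    push_cast
    ring

theorem isSerrePair_op : IsSerrePair opX opY := by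
  have hq := q_ne_zero
  constructor
  · rw [← mul_qComm_iff]
    refine LinearMap.ext fun v => funext fun c => funext fun b => funext fun a => ?_
    change opX (qComm opX opY v) c b a = q * qComm opX opY (opX v) c b a
    rcases b with _ | _ | b <;> cases a <;>
      simp only [opX_zero_zero, opX_zero_succ, opX_succ_zero, opX_succ_succ, qComm_op_zero,
        qComm_op_succ, mul_zero, add_zero, zero_add, Nat.cast_zero, Nat.cast_add, Nat.cast_one,
        zpow_add₀ hq, zpow_sub₀ hq, zpow_neg, zpow_one] <;>
      field_simp
  · rw [← qComm_mul_iff]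
    refine LinearMap.ext fun v => funext fun c => funext fun b => funext fun a => ?_
    change qComm opX opY (opY v) c b a = q * opY (qComm opX opY v) c b a
    cases b <;> cases c <;>
      simp only [opY_zero, opY_succ, qComm_op_zero, qComm_op_succ, mul_zero, Nat.cast_add,
        Nat.cast_one, zpow_add₀ hq, zpow_one]
    ring

/-- The operators of the generators. -/
def op : Fin 2 → Module.End K PBW := ![opX, opY]

theorem isSerrePair_op_of_ne {i j : Fin 2} (h : i ≠ j) : IsSerrePair (op i) (op j) := by
  fin_cases i <;> fin_cases j
  · exact absurd rfl h
  · exact isSerrePair_op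
  · exact isSerrePair_op.symm
  · exact absurd rfl h

/-- The action of `U_q^-(A₂)` on functions on `ℕ³`. -/
def rep : A2.U →ₐ[K] Module.End K PBW :=
  A2.liftU (FreeAlgebra.lift K op) (by
    rintro _ _ ⟨i, j, hij⟩
    rw [A2_serreExp hij, A2_d]
    simp only [map_sum, map_mul, map_pow, map_neg, map_one, map_zero, CartanDatum.map_divPow,
      FreeAlgebra.lift_ι_apply]
    refine (smul_eq_zero_iff_right q_add_inv_ne_zero).1 ?_
    rw [← (isSerrePair_op_of_ne hij).left]
    exact serre_sum_eq (op i) (op j))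

theorem rep_f (i : Fin 2) : rep (A2.f i) = op i := by
  rw [rep, CartanDatum.f, CartanDatum.liftU_mkU, FreeAlgebra.lift_ι_apply]

theorem rep_dp (i : Fin 2) (n : ℕ) : rep (dp (A2.f i) n) = dp (op i) n := by
  rw [dp, map_smul, map_pow, rep_f, dp]

/-- The basis function at a point of `ℕ³`. -/
def delta (c b a : ℕ) : PBW := fun c' b' a' => if c' = c ∧ b' = b ∧ a' = a then 1 else 0

/-- A function on `ℕ³` that is supported in one weight. -/
def HasWeight (v : PBW) (m n : ℕ) : Prop := ∀ c b a, v c b a ≠ 0 → a + b = m ∧ c + b = n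

theorem HasWeight.opX {v : PBW} {m n : ℕ} (h : HasWeight v m n) : HasWeight (opX v) (m + 1) n := by
  intro c b a hv
  by_contra hc
  refine hv ?_
  have h0 : ∀ c' b' a', ¬(a' + b' = m ∧ c' + b' = n) → v c' b' a' = 0 :=
    fun c' b' a' h' => by_contra fun h1 => h' (h c' b' a' h1)
  cases a <;> cases b
  · rw [opX_zero_zero]
  · rw [opX_succ_zero, h0 _ _ _ (by omega), mul_zero]
  · rw [opX_zero_succ, h0 _ _ _ (by omega), mul_zero]
  · rw [opX_succ_succ, h0 _ _ _ (by omega), h0 _ _ _ (by omega), mul_zero, mul_zero, add_zero]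

theorem HasWeight.opY {v : PBW} {m n : ℕ} (h : HasWeight v m n) : HasWeight (opY v) m (n + 1) := by
  intro c b a hv
  cases c with
  | zero => exact absurd (opY_zero v b a) hv
  | succ c =>
    have := h c b a (by rwa [opY_succ] at hv)
    omega

theorem HasWeight.smul {v : PBW} {m n : ℕ} (h : HasWeight v m n) (r : K) :
    HasWeight (r • v) m n :=
  fun c b a hv => h c b a (right_ne_zero_of_mul hv)

theorem HasWeight.dp_opX {v : PBW} {m n : ℕ} (h : HasWeight v m n) (k : ℕ) :
    HasWeight (dp QFold.opX k v) (m + k) n := by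
  refine HasWeight.smul (v := (QFold.opX ^ k) v) ?_ _
  induction k with
  | zero => exact h
  | succ k ih =>
    rw [pow_succ']
    exact ih.opX

theorem HasWeight.dp_opY {v : PBW} {m n : ℕ} (h : HasWeight v m n) (k : ℕ) :
    HasWeight (dp QFold.opY k v) m (n + k) := by
  refine HasWeight.smul (v := (QFold.opY ^ k) v) ?_ _
  induction k with
  | zero => exact h
  | succ k ih =>
    rw [pow_succ']
    exact ih.opY

theorem hasWeight_delta : HasWeight (delta 0 0 0) 0 0 := by
  intro c b a h
  by_contra h1
  exact h (if_neg (by omega))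

/-! ### Leading PBW terms of the monomials -/

theorem opX_pow_delta_zero (n : ℕ) : (opX ^ n) (delta 0 0 0) = delta 0 0 n := by
  induction n with
  | zero => rfl
  | succ n ih =>
    rw [pow_succ', Module.End.mul_apply, ih]
    funext c b a
    cases a <;> cases b <;>
      simp only [opX_zero_zero, opX_zero_succ, opX_succ_zero, opX_succ_succ, delta]
    · simp
    · simp
    · by_cases h : c = 0
      · simp [h]
      · simp [h]
    · simp

theorem opY_pow_delta (n a : ℕ) : (opY ^ n) (delta 0 0 a) = delta n 0 a := by
  induction n with
  | zero => rfl
  | succ n ih =>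
    rw [pow_succ', Module.End.mul_apply, ih]
    funext c b a
    cases c <;> simp [opY_zero, opY_succ, delta]

/-- Each application of `opX` raises the exponent of `z` by at most one. -/
theorem opX_pow_delta_le (n m s : ℕ) (c b a : ℕ) (h : (opX ^ n) (delta m 0 s) c b a ≠ 0) :
    b ≤ n := by
  induction n generalizing c b a with
  | zero =>
    by_contra h1
    exact h (if_neg (by omega))
  | succ n ih =>
    by_contra hb
    refine h ?_
    have h0 : ∀ c' b' a', n < b' → (opX ^ n) (delta m 0 s) c' b' a' = 0 :=
      fun c' b' a' h' => by_contra fun h1 => absurd (ih c' b' a' h1) (by omega)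
    rw [pow_succ', Module.End.mul_apply]
    cases a <;> cases b
    · omega
    · rw [opX_succ_zero, h0 _ _ _ (by omega), mul_zero]
    · omega
    · rw [opX_succ_succ, h0 _ _ _ (by omega), h0 _ _ _ (by omega), mul_zero, mul_zero, add_zero]

/-- The extreme coefficient arises in one way only: every `f_1` turns one `f_2` into a `z`. It is
therefore a product of nonzero quantum integers. -/
theorem opX_pow_delta_top (n r s : ℕ) : (opX ^ n) (delta (n + r) 0 s) r n s ≠ 0 := by
  induction n generalizing r with
  | zero => simp [delta]
  | succ n ih =>
    have h1 := mul_ne_zero (br_natCast_succ_ne_zero r) (ih (r + 1))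
    rw [show n + (r + 1) = n + 1 + r by ring] at h1
    rw [pow_succ', Module.End.mul_apply]
    cases s with
    | zero => rwa [opX_succ_zero]
    | succ s =>
      have h0 : (opX ^ n) (delta (n + 1 + r) 0 (s + 1)) r (n + 1) s = 0 :=
        by_contra fun h => absurd (opX_pow_delta_le _ _ _ _ _ _ h) (by omega)
      rwa [opX_succ_succ, h0, mul_zero, zero_add]

theorem dp_opX_opY_opX_delta (a b c : ℕ) : ∃ r : K, r ≠ 0 ∧
    (dp opX a * dp opY b * dp opX c) (delta 0 0 0) = r • (opX ^ a) (delta b 0 c) := by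
  refine ⟨(fact c)⁻¹ * ((fact b)⁻¹ * (fact a)⁻¹), ?_, ?_⟩
  · simp [fact_ne_zero]
  · simp only [dp, Module.End.mul_apply, LinearMap.smul_apply, map_smul, opX_pow_delta_zero,
      opY_pow_delta, smul_smul]

/-! ## The monomial basis of the integral form in type `A₂` -/

/-- The indices `(i, a, b, c)` of the basis monomials `f_i^(a) f_j^(b) f_i^(c)`: those with
`a + c ≤ b`, where `i` is the first vertex if `a + c = b`. -/
abbrev Idx : Type :=
  {p : Fin 2 × ℕ × ℕ × ℕ // p.2.1 + p.2.2.2 ≤ p.2.2.1 ∧ (p.1 = 1 → p.2.1 + p.2.2.2 < p.2.2.1)}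

/-- The basis monomials. -/
def basisMono (p : Idx) : A2.intForm := mono p.1.1 p.1.2.1 p.1.2.2.1 p.1.2.2.2

theorem ite_opp_eq_zero (i : Fin 2) : (if i = 0 then i else opp i) = 0 := by revert i; decide

theorem ite_opp_eq_one (i : Fin 2) : (if i = 0 then opp i else opp (opp i)) = 1 := by
  revert i; decide

theorem eq_one_or_opp_eq_one (i : Fin 2) : i = 1 ∨ opp i = 1 := by revert i; decide

/-- The automorphism `σ` of `U_q^-` if `i` is the second vertex, and the identity otherwise. -/
def twist (i : Fin 2) : A2.U →ₐ[K] A2.U :=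
  if i = 0 then AlgHom.id K A2.U else CartanDatum.sigma swap_isDiagramAut

theorem twist_mono (i j : Fin 2) (a b c : ℕ) :
    twist i (mono j a b c) = mono (if i = 0 then j else opp j) a b c := by
  rw [twist]
  split_ifs
  · rfl
  · simp only [coe_mono, ← fdiv_eq_dp, map_mul, CartanDatum.sigma_fdiv]

/-- The coordinate functionals that detect the basis monomials. -/
def coordFun (i : Fin 2) (c b a : ℕ) : A2.U →ₗ[K] K where
  toFun u := rep (twist i u) (delta 0 0 0) c b a
  map_add' u v := by
    rw [map_add, map_add]
    rfl
  map_smul' r u := by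
    rw [map_smul, map_smul]
    rfl

theorem coordFun_apply (i : Fin 2) (c b a : ℕ) (u : A2.U) :
    coordFun i c b a u = rep (twist i u) (delta 0 0 0) c b a := rfl

theorem rep_mono_zero (a b c : ℕ) :
    rep (mono 0 a b c : A2.U) = dp opX a * dp opY b * dp opX c := by
  rw [coe_mono, map_mul, map_mul, rep_dp, rep_dp, rep_dp]
  rfl

theorem rep_mono_one (a b c : ℕ) :
    rep (mono 1 a b c : A2.U) = dp opY a * dp opX b * dp opY c := by
  rw [coe_mono, map_mul, map_mul, rep_dp, rep_dp, rep_dp]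
  rfl

/-- The chosen coordinate is the PBW term `f_2^(b-a) z^a f_1^c`, which has the highest power of `z`
in the monomial of the first vertex. -/
theorem coordFun_mono_self (i : Fin 2) (a b c : ℕ) (h : a + c ≤ b) :
    coordFun i (b - a) a c (mono i a b c) ≠ 0 := by
  rw [coordFun_apply, twist_mono, ite_opp_eq_zero, rep_mono_zero]
  obtain ⟨r, hr, h1⟩ := dp_opX_opY_opX_delta a b c
  obtain ⟨m, rfl⟩ := Nat.exists_eq_add_of_le (show a ≤ b by omega)
  rw [h1, Nat.add_sub_cancel_left]
  exact mul_ne_zero hr (opX_pow_delta_top a m c)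

theorem coordFun_mono_same (i : Fin 2) (a b c a' b' c' : ℕ) (h : a + c ≤ b)
    (h1 : coordFun i (b - a) a c (mono i a' b' c') ≠ 0) :
    a ≤ a' ∧ b = b' ∧ a + c = a' + c' := by
  rw [coordFun_apply, twist_mono, ite_opp_eq_zero, rep_mono_zero] at h1
  have hw := ((hasWeight_delta.dp_opX c').dp_opY b').dp_opX a' _ _ _ h1
  obtain ⟨r, hr, h2⟩ := dp_opX_opY_opX_delta a' b' c'
  rw [h2] at h1
  have h3 := opX_pow_delta_le _ _ _ _ _ _ (right_ne_zero_of_mul h1)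
  omega

theorem coordFun_mono_opp (i : Fin 2) (a b c a' b' c' : ℕ) (h : a + c ≤ b)
    (h1 : coordFun i (b - a) a c (mono (opp i) a' b' c') ≠ 0) :
    b = a' + c' ∧ a + c = b' := by
  rw [coordFun_apply, twist_mono, ite_opp_eq_one, rep_mono_one] at h1
  have hw := ((hasWeight_delta.dp_opY c').dp_opX b').dp_opY a' _ _ _ h1
  omega

/-- Triangularity with respect to `a`. For monomials at the same vertex, the weight and the power of
`z` decide. For opposite vertices, equal weights force both monomials onto the wall, which `Idx`
forbids at the second vertex. -/
theorem coordFun_basisMono {p p' : Idx}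
    (h : coordFun p.1.1 (p.1.2.2.1 - p.1.2.1) p.1.2.1 p.1.2.2.2 (basisMono p') ≠ 0)
    (hle : p'.1.2.1 ≤ p.1.2.1) : p' = p := by
  obtain ⟨⟨i, a, b, c⟩, h1, h2⟩ := p
  obtain ⟨⟨i', a', b', c'⟩, h1', h2'⟩ := p'
  simp only [basisMono] at h h1 h2 h1' h2' hle
  rcases eq_or_eq_opp i i' with rfl | rfl
  · obtain ⟨_, _, _⟩ := coordFun_mono_same _ _ _ _ _ _ _ h1 h
    obtain rfl : a' = a := by omega
    obtain rfl : b' = b := by omega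
    obtain rfl : c' = c := by omega
    rfl
  · obtain ⟨_, _⟩ := coordFun_mono_opp _ _ _ _ _ _ _ h1 h
    rcases eq_one_or_opp_eq_one i with hi | hi
    · have := h2 hi
      omega
    · have := h2' hi
      omega

theorem linearIndependent_coe_basisMono :
    LinearIndependent K (fun p : Idx => (basisMono p : A2.U)) := by
  rw [linearIndependent_iff]
  intro l hl
  by_contra hne
  -- With `a` maximal in the support, the functional of `p` kills every other term of the relation.
  obtain ⟨p, hp, hmax⟩ := Finset.exists_max_image l.support (fun p : Idx => p.1.2.1)
    (Finsupp.support_nonempty_iff.2 hne)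
  have h := congrArg (coordFun p.1.1 (p.1.2.2.1 - p.1.2.1) p.1.2.1 p.1.2.2.2) hl
  rw [Finsupp.linearCombination_apply, Finsupp.sum, map_sum, map_zero,
    Finset.sum_eq_single_of_mem p hp] at h
  · rw [map_smul, smul_eq_mul] at h
    exact mul_ne_zero (Finsupp.mem_support_iff.1 hp)
      (coordFun_mono_self p.1.1 p.1.2.1 p.1.2.2.1 p.1.2.2.2 p.2.1) h
  · intro p' hp' hne'
    rw [map_smul, smul_eq_mul]
    by_contra h1
    exact hne' (coordFun_basisMono (right_ne_zero_of_mul h1) (hmax p' hp'))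

/-- Independence over `ℚ(q)` of elements of an integral form implies independence over `𝔸`. -/
theorem linearIndependent_of_coe {I ι : Type} (X : CartanDatum I) (v : ι → X.intForm)
    (h : LinearIndependent K (fun i => (v i : X.U))) : LinearIndependent A v := by
  have h1 : LinearIndependent A (fun i => (v i : X.U)) := by
    refine h.restrict_scalars ?_
    intro r s hrs
    simp only [Algebra.smul_def, mul_one] at hrs
    exact algebraMap_AK_injective hrs
  exact LinearIndependent.of_comp X.intForm.val.toLinearMap h1

theorem span_basisMono : ⊤ ≤ Submodule.span A (Set.range basisMono) := by
  rw [← monoSpan_eq_top, monoSpan]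
  refine Submodule.span_le.2 ?_
  rintro _ ⟨i, a, b, c, h, rfl⟩
  refine Submodule.subset_span ?_
  by_cases hi : i = 1 → a + c < b
  · exact ⟨⟨(i, a, b, c), h, hi⟩, rfl⟩
  · push Not at hi
    obtain ⟨rfl, hb⟩ := hi
    obtain rfl : b = a + c := by omega
    -- A wall monomial at the second vertex is a wall monomial at the first one with the outer
    -- exponents exchanged.
    refine ⟨⟨(0, c, a + c, a), by simp [add_comm], by simp⟩, ?_⟩
    rw [mono_swap]
    rfl

/-- The base change to `𝔸'` of a basis of an integral form. -/
def modBasis {I ι : Type} (X : CartanDatum I) (b : Module.Basis ι A X.intForm) :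
    Module.Basis ι A' X.UMod :=
  (b.baseChange A').map X.modEquiv.symm.toLinearEquiv

theorem modBasis_apply {I ι : Type} (X : CartanDatum I) (b : Module.Basis ι A X.intForm) (i : ι) :
    modBasis X b i = X.modEquiv.symm (1 ⊗ₜ[A] b i) := by
  simp [modBasis]

/-- The basis of the integral form of type `A₂` that consists of the basis monomials. -/
def intBasis : Module.Basis Idx A A2.intForm :=
  Module.Basis.mk (linearIndependent_of_coe A2 basisMono linearIndependent_coe_basisMono)
    span_basisMono

/-- The canonical ring homomorphism from an integral form to its base change. -/
def toMod {I : Type} (X : CartanDatum I) : X.intForm →+* X.UMod :=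
  (X.modEquiv.symm : A' ⊗[A] X.intForm →+* X.UMod).comp
    (Algebra.TensorProduct.includeRight : X.intForm →ₐ[A] A' ⊗[A] X.intForm).toRingHom

theorem toMod_apply {I : Type} (X : CartanDatum I) (u : X.intForm) :
    toMod X u = X.modEquiv.symm (1 ⊗ₜ[A] u) := rfl

theorem toMod_smul {I : Type} (X : CartanDatum I) (r : A) (u : X.intForm) :
    toMod X (r • u) = algebraMap A A' r • toMod X u := by
  rw [toMod_apply, toMod_apply, ← map_smul, TensorProduct.tmul_smul, TensorProduct.smul_tmul',
    TensorProduct.smul_tmul', Algebra.smul_def, smul_eq_mul]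

theorem toMod_fint {I : Type} (X : CartanDatum I) (i : I) (n : ℕ) :
    toMod X (X.fint i n) = X.fmod i n := rfl

/-- The basis of the base change that consists of the basis monomials. -/
def modBasisA2 : Module.Basis Idx A' A2.UMod := modBasis A2 intBasis

theorem modBasisA2_apply (p : Idx) : modBasisA2 p = toMod A2 (basisMono p) := by
  rw [modBasisA2, modBasis_apply, intBasis, Module.Basis.mk_apply, toMod_apply]

theorem σA2_toMod_mono (i : Fin 2) (a b c : ℕ) :
    σA2 (toMod A2 (mono i a b c)) = toMod A2 (mono (opp i) a b c) := by
  rw [σA2, toMod_apply, CartanDatum.sigmaMod_tmul, toMod_apply]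
  congr 2
  apply Subtype.ext
  change CartanDatum.sigma swap_isDiagramAut (mono i a b c : A2.U) = _
  simp only [coe_mono, ← fdiv_eq_dp, map_mul, CartanDatum.sigma_fdiv]

/-! ## The action of `σ` on the basis -/

theorem add_self_UMod (w : A2.UMod) : w + w = 0 := by
  have h : (2 : A2.UMod) = 0 := two_eq_zero
  rw [← two_mul, h, zero_mul]

/-- The involution of the indices that corresponds to `σ`. -/
def involIdx (p : Idx) : Idx :=
  if h : p.1.2.1 + p.1.2.2.2 < p.1.2.2.1 then
    ⟨(opp p.1.1, p.1.2.1, p.1.2.2.1, p.1.2.2.2), p.2.1, fun _ => h⟩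
  else ⟨(p.1.1, p.1.2.2.2, p.1.2.2.1, p.1.2.1), by have := p.2.1; simp only; omega,
    fun hp => absurd (p.2.2 hp) h⟩

theorem involIdx_of_lt {p : Idx} (h : p.1.2.1 + p.1.2.2.2 < p.1.2.2.1) :
    (involIdx p).1 = (opp p.1.1, p.1.2.1, p.1.2.2.1, p.1.2.2.2) := by rw [involIdx, dif_pos h]

theorem involIdx_of_not_lt {p : Idx} (h : ¬ p.1.2.1 + p.1.2.2.2 < p.1.2.2.1) :
    (involIdx p).1 = (p.1.1, p.1.2.2.2, p.1.2.2.1, p.1.2.1) := by rw [involIdx, dif_neg h]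

theorem involIdx_involutive : Function.Involutive involIdx := by
  intro p
  apply Subtype.ext
  by_cases h : p.1.2.1 + p.1.2.2.2 < p.1.2.2.1
  · have h1 := involIdx_of_lt h
    rw [involIdx_of_lt (by rw [h1]; exact h), h1, opp_opp]
  · have h1 := involIdx_of_not_lt h
    rw [involIdx_of_not_lt (by rw [h1, add_comm]; exact h), h1]

theorem fst_eq_zero_of_not_lt {p : Idx} (h : ¬ p.1.2.1 + p.1.2.2.2 < p.1.2.2.1) : p.1.1 = 0 := by
  by_contra hi
  exact h (p.2.2 (by omega))

theorem σA2_modBasis (p : Idx) : σA2 (modBasisA2 p) = modBasisA2 (involIdx p) := by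
  rw [modBasisA2_apply, modBasisA2_apply, basisMono, σA2_toMod_mono, basisMono]
  by_cases h : p.1.2.1 + p.1.2.2.2 < p.1.2.2.1
  · rw [involIdx_of_lt h]
  · rw [involIdx_of_not_lt h, fst_eq_zero_of_not_lt h,
      show p.1.2.2.1 = p.1.2.2.2 + p.1.2.1 by have := p.2.1; omega, mono_swap 0 p.1.2.2.2]

/-- The index of the fixed basis element `f_1^(a) f_2^(2a) f_1^(a)`. -/
def fixedIdx (a : ℕ) : Idx := ⟨(0, a, 2 * a, a), by simp only; omega, by simp⟩

theorem fixedIdx_injective : Function.Injective fixedIdx := fun a b h => by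
  have := congrArg (fun p : Idx => p.1.2.1) h
  exact this

theorem eq_fixedIdx_of_involIdx_eq {p : Idx} (h : involIdx p = p) : ∃ a, p = fixedIdx a := by
  by_cases hlt : p.1.2.1 + p.1.2.2.2 < p.1.2.2.1
  · have h1 := congrArg (fun p : Idx => p.1.1) h
    simp only [involIdx_of_lt hlt] at h1
    exact absurd h1.symm (opp_ne _)
  · have h1 := congrArg (fun p : Idx => p.1.2.1) h
    simp only [involIdx_of_not_lt hlt] at h1
    have h2 := fst_eq_zero_of_not_lt hlt
    have h3 := p.2.1
    obtain ⟨⟨i, a, b, c⟩, _⟩ := p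
    simp only at h1 h2 h3 hlt
    subst h1 h2
    refine ⟨c, Subtype.ext ?_⟩
    simp only [fixedIdx]
    congr 3
    omega

theorem involIdx_fixedIdx (a : ℕ) : involIdx (fixedIdx a) = fixedIdx a := by
  apply Subtype.ext
  rw [involIdx_of_not_lt (by simp only [fixedIdx]; omega)]
  rfl

theorem toMod_mono_opp (i : Fin 2) (a : ℕ) :
    toMod A2 (mono (opp i) a (2 * a) a) = toMod A2 (mono i a (2 * a) a) := by
  rw [two_mul, mono_swap i]

theorem gLift_eq_toMod (a : ℕ) : gLift a = toMod A2 (mono 1 a (2 * a) a) := by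
  rw [mono, map_mul, map_mul]
  rfl

theorem gLift_eq_modBasis (a : ℕ) : gLift a = modBasisA2 (fixedIdx a) := by
  rw [gLift_eq_toMod, modBasisA2_apply]
  exact toMod_mono_opp 0 a

theorem gLift_mem (a : ℕ) : gLift a ∈ fixedAlg σA2 := by
  rw [mem_fixedAlg, gLift_eq_modBasis, σA2_modBasis, involIdx_fixedIdx]

theorem repr_σA2 (x : A2.UMod) (p : Idx) :
    modBasisA2.repr (σA2 x) p = modBasisA2.repr x (involIdx p) := by
  have h : (Finsupp.lapply p ∘ₗ modBasisA2.repr.toLinearMap) ∘ₗ σA2.toLinearMap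
      = Finsupp.lapply (involIdx p) ∘ₗ modBasisA2.repr.toLinearMap := by
    refine modBasisA2.ext fun p' => ?_
    change modBasisA2.repr (σA2 (modBasisA2 p')) p = modBasisA2.repr (modBasisA2 p') (involIdx p)
    rw [σA2_modBasis, Module.Basis.repr_self, Module.Basis.repr_self, Finsupp.single_apply,
      Finsupp.single_apply]
    simp only [involIdx_involutive.eq_iff]
  exact LinearMap.congr_fun h x

/-- A fundamental domain for the non-fixed indices under the involution. -/
def IsHalf (p : Idx) : Prop :=
  (p.1.2.1 + p.1.2.2.2 < p.1.2.2.1 ∧ p.1.1 = 0) ∨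
    (¬ p.1.2.1 + p.1.2.2.2 < p.1.2.2.1 ∧ p.1.2.1 < p.1.2.2.2)

theorem isHalf_involIdx {p : Idx} (h : involIdx p ≠ p) : IsHalf (involIdx p) ↔ ¬ IsHalf p := by
  by_cases hlt : p.1.2.1 + p.1.2.2.2 < p.1.2.2.1
  · have h1 := involIdx_of_lt hlt
    have h2 : opp p.1.1 = 0 ↔ ¬ p.1.1 = 0 := by
      generalize p.1.1 = i
      revert i
      decide
    simp [IsHalf, h1, hlt, h2]
  · have h1 := involIdx_of_not_lt hlt
    have h2 : p.1.2.1 ≠ p.1.2.2.2 := by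
      intro h3
      refine h (Subtype.ext ?_)
      rw [h1, h3]
      obtain ⟨⟨i, a, b, c⟩, _⟩ := p
      simp only at h3
      subst h3
      rfl
    simp only [IsHalf, h1]
    omega

theorem not_isHalf_of_fixed {p : Idx} (h : involIdx p = p) : ¬ IsHalf p := by
  obtain ⟨a, rfl⟩ := eq_fixedIdx_of_involIdx_eq h
  simp only [IsHalf, fixedIdx]
  omega

/-- A fixed element is a sum of multiples of the `g^(a)` and an orbit sum. -/
theorem exists_fixed_add_orbit (x : A2.UMod) (hx : σA2 x = x) :
    ∃ l : ℕ →₀ A', ∃ y : A2.UMod, x = Finsupp.linearCombination A' gLift l + (y + σA2 y) := by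
  classical
  let r := modBasisA2.repr x
  have hr : ∀ p, r (involIdx p) = r p := fun p => by
    change modBasisA2.repr x (involIdx p) = _
    rw [← repr_σA2, hx]
  -- The coordinates at fixed indices give `l`. For `y`, one index is kept from each two-element
  -- orbit; `σ y` supplies the other, since `r` is constant on orbits.
  refine ⟨r.comapDomain fixedIdx fixedIdx_injective.injOn,
    modBasisA2.repr.symm (r.filter IsHalf), ?_⟩
  apply modBasisA2.repr.injective
  have hl : modBasisA2.repr (Finsupp.linearCombination A' gLift
      (r.comapDomain fixedIdx fixedIdx_injective.injOn))
        = (r.comapDomain fixedIdx fixedIdx_injective.injOn).mapDomain fixedIdx := by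
    rw [← modBasisA2.repr.apply_symm_apply (Finsupp.mapDomain _ _), Module.Basis.repr_symm_apply,
      Finsupp.linearCombination_mapDomain]
    congr 3
    funext a
    exact gLift_eq_modBasis a
  ext p
  rw [map_add, map_add, Finsupp.add_apply, Finsupp.add_apply, repr_σA2, LinearEquiv.apply_symm_apply,
    hl, Finsupp.filter_apply, Finsupp.filter_apply, hr]
  by_cases h : involIdx p = p
  · have h1 := not_isHalf_of_fixed h
    rw [h, if_neg h1]
    obtain ⟨a, rfl⟩ := eq_fixedIdx_of_involIdx_eq h
    rw [Finsupp.mapDomain_apply fixedIdx_injective, Finsupp.comapDomain_apply]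
    simp [r]
  · have h1 := isHalf_involIdx h
    have h2 : p ∉ Set.range fixedIdx := by
      rintro ⟨a, rfl⟩
      exact h (involIdx_fixedIdx a)
    rw [Finsupp.mapDomain_of_notMem_range _ _ h2]
    by_cases h3 : IsHalf p
    · rw [if_pos h3, if_neg (by rw [h1]; exact not_not.2 h3), add_zero, zero_add]
    · rw [if_neg h3, if_pos (h1.2 h3), zero_add, zero_add]

/-! ## The algebra `V_q` -/

theorem orbitSum_eq_add {x : A2.UMod} (hx : σA2 x ≠ x) : orbitSum σA2 x = x + σA2 x := by
  rw [orbitSum_of_ne Nat.prime_two σA2_iterate x hx, Finset.sum_range_succ, Finset.sum_range_one]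
  rfl

/-- Removes the condition `σ x ≠ x` on the generators of `J`: for fixed `x` the sum is `2x = 0`. -/
theorem π_eq_zero_of_eq_add {z : fixedAlg σA2} {x : A2.UMod} (hz : (z : A2.UMod) = x + σA2 x) :
    π z = 0 := by
  refine Ideal.Quotient.eq_zero_iff_mem.2 ?_
  change z ∈ orbitSubmodule σA2
  by_cases hx : σA2 x = x
  · have : z = 0 := Subtype.ext (by rw [hz, hx, add_self_UMod]; rfl)
    rw [this]
    exact Submodule.zero_mem _
  · exact Submodule.subset_span ⟨x, hx, by rw [hz, orbitSum_eq_add hx]⟩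

/-- A coordinate at a fixed index takes the same value on `x` and `σ x`, so in characteristic 2 it
kills orbit sums, and hence `J`. This gives the independence of the `g^(a)`. -/
theorem repr_fixedIdx_eq_zero {z : fixedAlg σA2} (hz : π z = 0) (a : ℕ) :
    modBasisA2.repr (z : A2.UMod) (fixedIdx a) = 0 := by
  have h1 : z ∈ orbitSubmodule σA2 := Ideal.Quotient.eq_zero_iff_mem.1 hz
  let ψ : fixedAlg σA2 →ₗ[A'] A' := Finsupp.lapply (fixedIdx a) ∘ₗ
    modBasisA2.repr.toLinearMap ∘ₗ (fixedAlg σA2).val.toLinearMap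
  have h2 : orbitSubmodule σA2 ≤ LinearMap.ker ψ := by
    refine Submodule.span_le.2 ?_
    rintro y ⟨x, hx, hy⟩
    change modBasisA2.repr (y : A2.UMod) (fixedIdx a) = 0
    rw [hy, orbitSum_eq_add hx, map_add, Finsupp.add_apply, repr_σA2, involIdx_fixedIdx,
      CharTwo.add_self_eq_zero]
  exact h2 h1

/-- The element `g^(a)` of `V_q`. -/
def gElt (a : ℕ) : Vq := π ⟨gLift a, gLift_mem a⟩

theorem coe_linearCombination (l : ℕ →₀ A') :
    ((Finsupp.linearCombination A' (fun a => (⟨gLift a, gLift_mem a⟩ : fixedAlg σA2)) l :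
      fixedAlg σA2) : A2.UMod) = Finsupp.linearCombination A' gLift l :=
  Finsupp.apply_linearCombination A' (fixedAlg σA2).val.toLinearMap _ l

theorem π_linearCombination (l : ℕ →₀ A') :
    π (Finsupp.linearCombination A' (fun a => (⟨gLift a, gLift_mem a⟩ : fixedAlg σA2)) l)
      = Finsupp.linearCombination A' gElt l :=
  Finsupp.apply_linearCombination A' π.toLinearMap _ l

theorem linearIndependent_gElt : LinearIndependent A' gElt := by
  rw [linearIndependent_iff]
  intro l hl
  rw [← π_linearCombination] at hl
  ext a : 1
  have h := repr_fixedIdx_eq_zero hl a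
  rw [coe_linearCombination, show gLift = modBasisA2 ∘ fixedIdx from funext gLift_eq_modBasis,
    ← Finsupp.linearCombination_mapDomain, Module.Basis.repr_linearCombination,
    Finsupp.mapDomain_apply fixedIdx_injective] at h
  exact h

theorem span_gElt : ⊤ ≤ Submodule.span A' (Set.range gElt) := by
  rintro v -
  obtain ⟨x, rfl⟩ := Ideal.Quotient.mkₐ_surjective A' JA2 v
  obtain ⟨l, y, h⟩ := exists_fixed_add_orbit x x.2
  have h1 : π (x - Finsupp.linearCombination A'
      (fun a => (⟨gLift a, gLift_mem a⟩ : fixedAlg σA2)) l) = 0 := by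
    refine π_eq_zero_of_eq_add (x := y) ?_
    rw [AddSubgroupClass.coe_sub, coe_linearCombination, sub_eq_iff_eq_add', ← h]
  rw [map_sub, sub_eq_zero, π_linearCombination] at h1
  exact Finsupp.mem_span_range_iff_exists_finsupp.2 ⟨l, h1.symm⟩

/-- The basis of `V_q` that consists of the elements `g^(a)`. -/
def gBasis : Module.Basis ℕ A' Vq := Module.Basis.mk linearIndependent_gElt span_gElt

theorem gBasis_apply (a : ℕ) : gBasis a = gElt a := Module.Basis.mk_apply ..

theorem gElt_zero : gElt 0 = 1 := by
  have : (⟨gLift 0, gLift_mem 0⟩ : fixedAlg σA2) = 1 := by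
    apply Subtype.ext
    change gLift 0 = 1
    rw [gLift_eq_toMod, mono, fint_zero, Nat.mul_zero, fint_zero, mul_one, mul_one, map_one]
  rw [gElt, this, map_one]

/-- The outer monomials in `IsSerrePair.dp_palindrome_mul` lie on the wall, since `(m+3) + (m+1) =
2(m+2)`. By `mono_swap` they are exchanged by `σ`, so their sum vanishes in `V_q`, and
`qInt_pow_four` converts the remaining coefficient. -/
theorem gElt_one_mul (a : ℕ) : gElt 1 * gElt a = qInt (ZMod 2) 4 (a + 1) • gElt (a + 1) := by
  rcases a with _ | m
  · rw [gElt_zero, mul_one, qInt_one, one_smul]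
  obtain ⟨u, hu⟩ := (isSerrePair_f (i := 0) (j := 1) (by decide)).dp_palindrome_mul m
  have h1 : mono 1 1 (2 * 1) 1 * mono 1 (m + 1) (2 * (m + 1)) (m + 1)
      = (qInt ℤ 1 (m + 2) ^ 4) • mono 1 (m + 2) (2 * (m + 2)) (m + 2)
        + u • (mono 1 (m + 3) (2 * (m + 2)) (m + 1) + mono 1 (m + 1) (2 * (m + 2)) (m + 3)) := by
    apply Subtype.ext
    simp only [algebraMap_smul] at hu
    simp only [MulMemClass.coe_mul, AddMemClass.coe_add, SetLike.val_smul, coe_mono]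
    exact hu
  have h2 : mono 1 (m + 1) (2 * (m + 2)) (m + 3) = mono (opp 1) (m + 3) (2 * (m + 2)) (m + 1) := by
    rw [show 2 * (m + 2) = (m + 1) + (m + 3) by ring, mono_swap]
  have h3 := congrArg (toMod A2) h1
  rw [h2, map_mul, map_add, toMod_smul, toMod_smul, map_add, ← σA2_toMod_mono, map_pow,
    algebraMap_qInt, qInt_pow_four, ← gLift_eq_toMod, ← gLift_eq_toMod, ← gLift_eq_toMod] at h3
  rw [← sub_eq_zero, gElt, gElt, gElt, ← map_mul, ← map_smul, ← map_sub]
  refine π_eq_zero_of_eq_add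
    (x := algebraMap A A' u • toMod A2 (mono 1 (m + 3) (2 * (m + 2)) (m + 1))) ?_
  rw [AddSubgroupClass.coe_sub, sub_eq_iff_eq_add', map_smul, ← smul_add]
  exact h3

theorem qFact_smul_gElt (a : ℕ) : qFact (ZMod 2) 4 a • gElt a = gElt 1 ^ a := by
  induction a with
  | zero => rw [qFact_zero, one_smul, pow_zero, gElt_zero]
  | succ a ih => rw [pow_succ', ← ih, mul_smul_comm, gElt_one_mul, smul_smul, qFact_succ]

/-- After multiplication by the factorials both sides are powers of `g`. The factorials can be
cancelled coordinatewise because `gBasis` is a basis over a domain. -/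
theorem gElt_mul_gElt {a b : ℕ} {c : A'}
    (hc : c * (qFact (ZMod 2) 4 a * qFact (ZMod 2) 4 b) = qFact (ZMod 2) 4 (a + b)) :
    gElt a * gElt b = c • gElt (a + b) := by
  have h : (qFact (ZMod 2) 4 a * qFact (ZMod 2) 4 b) • (gElt a * gElt b)
      = (qFact (ZMod 2) 4 a * qFact (ZMod 2) 4 b) • (c • gElt (a + b)) := by
    rw [smul_smul, mul_comm _ c, hc, qFact_smul_gElt, ← smul_mul_smul_comm, qFact_smul_gElt,
      qFact_smul_gElt, pow_add]
  have h0 : qFact (ZMod 2) 4 a * qFact (ZMod 2) 4 b ≠ 0 :=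
    mul_ne_zero (qFact_ne_zero _ (by decide) a) (qFact_ne_zero _ (by decide) b)
  apply gBasis.repr.injective
  ext p : 1
  have h1 := congrArg (fun v => gBasis.repr v p) h
  simp only [map_smul, Finsupp.smul_apply, smul_eq_mul] at h1 ⊢
  exact mul_left_cancel₀ h0 h1

/-! ## Type `C₁` -/

theorem C1_d : C1.d () = 4 := by simp [CartanDatum.d, C1]

/-- The homomorphism from `U_q^-(C₁)` to polynomials in one variable. -/
def toPoly : C1.U →ₐ[K] Polynomial K :=
  C1.liftU (FreeAlgebra.lift K fun _ => Polynomial.X) (by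
    rintro _ _ ⟨i, j, hij⟩
    exact absurd (Subsingleton.elim i j) hij)

/-- The images in `K[X]` are nonzero multiples of the distinct powers of `X`. -/
theorem linearIndependent_coe_fint :
    LinearIndependent K (fun n => (C1.fint () n : C1.U)) := by
  have h0 : ∀ n, (algebraMap A K (qFact ℤ 4 n))⁻¹ ≠ 0 := fun n => by
    rw [Ne, inv_eq_zero, map_eq_zero_iff _ algebraMap_AK_injective]
    exact qFact_ne_zero ℤ (by decide) n
  have h1 := (Polynomial.basisMonomials K).linearIndependent.units_smul
    (fun n => Units.mk0 _ (h0 n))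
  refine LinearIndependent.of_comp toPoly.toLinearMap ?_
  have e : toPoly.toLinearMap ∘ (fun n => (C1.fint () n : C1.U))
      = (fun n => Units.mk0 _ (h0 n)) • ⇑(Polynomial.basisMonomials K) := by
    funext n
    change toPoly (divPow (C1.d ()) (C1.f ()) n) = _
    rw [CartanDatum.map_divPow, C1_d, CartanDatum.f, toPoly, CartanDatum.liftU_mkU,
      FreeAlgebra.lift_ι_apply, divPow, Pi.smul_apply', Polynomial.coe_basisMonomials,
      ← Polynomial.monomial_one_right_eq_X_pow]
    rfl
  rw [e]
  exact h1

theorem C1_fint_mul_fint {m n : ℕ} {u : A}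
    (hu : u * (qFact ℤ 4 m * qFact ℤ 4 n) = qFact ℤ 4 (m + n)) :
    C1.fint () m * C1.fint () n = u • C1.fint () (m + n) :=
  fint_mul_fint_eq_smul C1 () (by rw [C1_d]; decide) (by rw [C1_d]; exact hu)

theorem span_fint : ⊤ ≤ Submodule.span A (Set.range (C1.fint ())) := by
  rw [eq_top_of_fint_mul_mem C1 (Submodule.span A (Set.range (C1.fint ())))
    (Submodule.subset_span ⟨0, fint_zero C1 ()⟩)]
  rintro ⟨⟩ n v hv
  refine Submodule.span_induction (p := fun v _ => C1.fint () n * v ∈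
    Submodule.span A (Set.range (C1.fint ()))) ?_ ?_ ?_ ?_ hv
  · rintro _ ⟨m, rfl⟩
    obtain ⟨u, hu⟩ := exists_qBinom ℤ 4 n m
    rw [C1_fint_mul_fint hu]
    exact Submodule.smul_mem _ _ (Submodule.subset_span ⟨_, rfl⟩)
  · rw [mul_zero]
    exact Submodule.zero_mem _
  · intro u v _ _ hu hv
    rw [mul_add]
    exact Submodule.add_mem _ hu hv
  · intro r u _ hu
    rw [mul_smul_comm]
    exact Submodule.smul_mem _ _ hu

/-- The basis of the base change in type `C₁` that consists of the divided powers. -/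
def modBasisC1 : Module.Basis ℕ A' C1.UMod :=
  modBasis C1 (Module.Basis.mk (linearIndependent_of_coe C1 _ linearIndependent_coe_fint) span_fint)

theorem modBasisC1_apply (a : ℕ) : modBasisC1 a = C1.fmod () a := by
  rw [modBasisC1, modBasis_apply, Module.Basis.mk_apply]
  rfl

theorem fmod_mul_fmod {m n : ℕ} {u : A}
    (hu : u * (qFact ℤ 4 m * qFact ℤ 4 n) = qFact ℤ 4 (m + n)) :
    C1.fmod () m * C1.fmod () n = algebraMap A A' u • C1.fmod () (m + n) := by
  rw [← toMod_fint, ← toMod_fint, ← map_mul, C1_fint_mul_fint hu, toMod_smul, toMod_fint]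

/-! ## The isomorphism -/

/-- The linear isomorphism that maps the divided powers to the `g^(a)`. -/
def foldLinearEquiv : C1.UMod ≃ₗ[A'] Vq := modBasisC1.equiv gBasis (Equiv.refl ℕ)

theorem foldLinearEquiv_fmod (a : ℕ) : foldLinearEquiv (C1.fmod () a) = gElt a := by
  rw [← modBasisC1_apply, foldLinearEquiv, Module.Basis.equiv_apply, gBasis_apply, Equiv.refl_apply]

/-- By bilinearity it suffices to compare products of basis elements, and both bases have the
reduction of the same quantum binomial, with `d = 4`, as structure constant. -/
theorem foldLinearEquiv_mul (u v : C1.UMod) :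
    foldLinearEquiv (u * v) = foldLinearEquiv u * foldLinearEquiv v := by
  have h : (LinearMap.mul A' C1.UMod).compr₂ foldLinearEquiv.toLinearMap
      = (LinearMap.mul A' Vq).compl₁₂ foldLinearEquiv.toLinearMap foldLinearEquiv.toLinearMap := by
    refine modBasisC1.ext fun a => modBasisC1.ext fun b => ?_
    obtain ⟨c, hc⟩ := exists_qBinom ℤ 4 a b
    have hc' : algebraMap A A' c * (qFact (ZMod 2) 4 a * qFact (ZMod 2) 4 b)
        = qFact (ZMod 2) 4 (a + b) := by
      rw [← algebraMap_qFact, ← algebraMap_qFact, ← algebraMap_qFact, ← map_mul, ← map_mul, hc]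
    rw [modBasisC1_apply, modBasisC1_apply]
    change foldLinearEquiv (C1.fmod () a * C1.fmod () b)
      = foldLinearEquiv (C1.fmod () a) * foldLinearEquiv (C1.fmod () b)
    rw [fmod_mul_fmod hc, map_smul, foldLinearEquiv_fmod, foldLinearEquiv_fmod,
      foldLinearEquiv_fmod, gElt_mul_gElt hc']
  exact LinearMap.congr_fun (LinearMap.congr_fun h u) v

theorem fmod_zero : C1.fmod () 0 = 1 := by
  rw [← toMod_fint, fint_zero, map_one]

/-- The isomorphism of the base change in type `C₁` with `V_q`. -/
def foldEquiv : C1.UMod ≃ₐ[A'] Vq :=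
  AlgEquiv.ofLinearEquiv foldLinearEquiv
    (by rw [← fmod_zero, foldLinearEquiv_fmod, gElt_zero]) foldLinearEquiv_mul

theorem foldEquiv_fmod (a : ℕ) : foldEquiv (C1.fmod () a) = gElt a := foldLinearEquiv_fmod a

end QFold

end

theorem proposition2p4 :
    ∃ hfix : ∀ a : ℕ, QFold.gLift a ∈ QFold.fixedAlg QFold.σA2,
      (∀ a : ℕ,
        QFold.qFact (ZMod 2) 4 a • QFold.π ⟨QFold.gLift a, hfix a⟩
          = QFold.π ⟨QFold.gLift 1, hfix 1⟩ ^ a) ∧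
      ∃! Φ : QFold.C1.UMod ≃ₐ[QFold.A'] QFold.Vq,
        ∀ a : ℕ, Φ (QFold.C1.fmod () a) = QFold.π ⟨QFold.gLift a, hfix a⟩ := by
  refine ⟨QFold.gLift_mem, QFold.qFact_smul_gElt, QFold.foldEquiv, QFold.foldEquiv_fmod, ?_⟩
  intro Φ hΦ
  -- Uniqueness needs linearity only, since the divided powers form a basis.
  apply AlgEquiv.toLinearEquiv_injective
  refine QFold.modBasisC1.ext' fun a => ?_
  rw [QFold.modBasisC1_apply]
  exact (hΦ a).trans (QFold.foldEquiv_fmod a).symm
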